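/- Let $0<|q|<1$, fix a square root $q^{1/2}$ of $q$, and put $q^{m/2}=(q^{1/2})^m$ for $m\in\mathbb Z$. Write $(x;q)_\infty=\prod_{n\ge 0}(1-xq^n)$ and $(x_1,\dots,x_r;q)_\infty=(x_1;q)_\infty\cdots(x_r;q)_\infty$. Let $a_1,a_2,a_3,b_1,b_2,b_3$ be complex numbers with $a_1a_2a_3=b_1b_2b_3=q^{1/2}$ that are generic, in the sense that no product $a_jb_k$ and no quotient $a_j/a_k$ or $b_j/b_k$ with $j\ne k$ is an integer power of $q$, and let $M_j,N_j$ ($j=1,2,3$) be integers with $M_1+M_2+M_3=N_1+N_2+N_3=0$. Then $$\sum_{m=-\infty}^\infty\oint\prod_{j=1}^3\frac{(q^{1+m/2}/a_jz,\,q^{1-m/2}z/b_j;q)_\infty}{(q^{M_j+m/2}a_jz,\,q^{N_j-m/2}b_j/z;q)_\infty}\,\frac{(-1)^m}{z^{3m}}\,\frac{dz}{2\pi\mathrm i z}=\frac{1}{\prod_{j=1}^3q^{\binom{M_j}2+\binom{N_j}2}a_j^{M_j}b_j^{N_j}}\prod_{j,k=1}^3\frac{(q/a_jb_k;q)_\infty}{(a_jb_kq^{M_j+N_k};q)_\infty},$$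 where the sum over $m$ converges absolutely and, for each $m$, the integral is over any positively oriented closed contour (piecewise $C^1$) in $\mathbb C\setminus\{0\}$ separating the poles of the integrand that form geometric sequences converging to $0$, namely $z=q^{N_j-m/2+k}b_j$ with $k\ge\max(0,m-N_j)$, from those converging to $\infty$, namely $z=q^{-M_j-m/2-k}/a_j$ with $k\ge\max(0,-m-M_j)$; that is, it passes through none of these points, and it has winding number $1$ around $0$ and around the former poles and winding number $0$ around the latter. -/

import Mathlib

noncomputable section

namespace SQED

/-- The infinite `q`-shifted factorial `(x; q)_∞ = ∏_{n ≥ 0} (1 - x q^n)`, for `|q| < 1`. -/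
def qPoch (x q : ℂ) : ℂ := ∏' n : ℕ, (1 - x * q ^ n)

/-- The contour integral `∫_γ f(z) dz` of a complex function along a path in `ℂ`. -/
def contourIntegral (f : ℂ → ℂ) {x y : ℂ} (γ : Path x y) : ℂ :=
  curveIntegral (fun z => ContinuousLinearMap.toSpanSingleton ℂ (f z)) γ

/-- A path is piecewise `C^1`: there are finitely many break points such that the path is `C^1` on
every closed subinterval of `[0, 1]` without break points in its interior. -/
def IsPiecewiseC1 {x y : ℂ} (γ : Path x y) : Prop :=
  ∃ P : Finset ℝ, ∀ c d : ℝ, 0 ≤ c → c < d → d ≤ 1 → Disjoint (Set.Ioo c d) (P : Set ℝ) →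
    ContDiffOn ℝ 1 γ.extend (Set.Icc c d)

/-- The winding number `(2πi)⁻¹ ∮_γ dz / (z - w)` of a closed path around a point `w` off it. -/
def windingNumber {x : ℂ} (γ : Path x x) (w : ℂ) : ℂ :=
  (2 * Real.pi * Complex.I)⁻¹ * contourIntegral (fun z => (z - w)⁻¹) γ

/-- The closed path `γ` is a positively oriented contour that separates the points of `S` (and the
origin), which it encircles once, from the points of `T`, which lie outside of it. -/
structure IsSeparatingContour {x : ℂ} (γ : Path x x) (S T : Set ℂ) : Prop where
  piecewiseC1 : IsPiecewiseC1 γ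
  inside : ∀ w ∈ insert 0 S, w ∉ Set.range γ ∧ windingNumber γ w = 1
  outside : ∀ w ∈ T, w ∉ Set.range γ ∧ windingNumber γ w = 0

/-- The function `∏_j (q^{1+m/2}/(a_j z), q^{1-m/2} z/b_j; q)_∞ /
(q^{M_j+m/2} a_j z, q^{N_j-m/2} b_j/z; q)_∞ · (-1)^m z^{-3m}`,
where `r` is the chosen square root of `q`, so that `q^{m/2} = r^m`. -/
def integrand (q r : ℂ) (a b : Fin 3 → ℂ) (M N : Fin 3 → ℤ) (m : ℤ) (z : ℂ) : ℂ :=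
  (∏ j, qPoch (q * r ^ m / (a j * z)) q * qPoch (q * r ^ (-m) * z / b j) q /
      (qPoch (q ^ M j * r ^ m * a j * z) q * qPoch (q ^ N j * r ^ (-m) * b j / z) q)) *
    ((-1) ^ m * z ^ (-3 * m))

/-- The poles of the integrand in geometric sequences converging to `0`: the zeros
`z = q^{N_j - m/2 + k} b_j`, `k ≥ 0`, of `(q^{N_j-m/2} b_j/z; q)_∞`, except those with
`k < m - N_j`, which are cancelled by zeros of `(q^{1-m/2} z/b_j; q)_∞`. -/
def polesToZero (q r : ℂ) (b : Fin 3 → ℂ) (N : Fin 3 → ℤ) (m : ℤ) : Set ℂ :=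
  {z | ∃ (j : Fin 3) (k : ℤ), 0 ≤ k ∧ m - N j ≤ k ∧ z = q ^ (N j + k) * r ^ (-m) * b j}

/-- The poles of the integrand in geometric sequences converging to `∞`: the zeros
`z = 1 / (q^{M_j + m/2 + k} a_j)`, `k ≥ 0`, of `(q^{M_j+m/2} a_j z; q)_∞`, except those with
`k < -m - M_j`, which are cancelled by zeros of `(q^{1+m/2}/(a_j z); q)_∞`. -/
def polesToInfinity (q r : ℂ) (a : Fin 3 → ℂ) (M : Fin 3 → ℤ) (m : ℤ) : Set ℂ :=
  {z | ∃ (j : Fin 3) (k : ℤ), 0 ≤ k ∧ -m - M j ≤ k ∧ z = (q ^ (M j + k) * r ^ m * a j)⁻¹}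

/-- Genericity of the parameters: no product `a_j b_k`, and no quotient `a_j / a_k` or `b_j / b_k`
with `j ≠ k`, is an integer power of `q`. -/
structure IsGeneric (q : ℂ) (a b : Fin 3 → ℂ) : Prop where
  mul_ne : ∀ (j k : Fin 3) (n : ℤ), a j * b k ≠ q ^ n
  left_ne : ∀ (j k : Fin 3) (n : ℤ), j ≠ k → a j ≠ q ^ n * a k
  right_ne : ∀ (j k : Fin 3) (n : ℤ), j ≠ k → b j ≠ q ^ n * b k

end SQED

end

/-! ### The products $(x;q)_\infty$, $(x;q)_n$ and the theta function -/

noncomputable section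

namespace SQED

open Filter Topology Finset

variable {q : ℂ}

/-! The integrals are evaluated by residues, the resulting double series factors, and the factors
are known through the nonterminating q-Saalschütz summation.

Fix m. The conditions on the products of the `a j` and `b j` and on the sum of the `N j` make the
integrand at q z asymptotic to q² times its value at z as z tends to 0. Its integrals against dz/z
over circles of radius ρ|q|^n therefore tend to 0, and the integral over the contour is the sum of
the residues at all poles tending to 0 (`contourIntegral_integrand_eq_tsum`).

The residue at the pole p = q^(N_j+s) r^(-m) b_j splits (`residueAt_eq`). Write p = r^m y = r^(-m)
w, with y = b_j q^(s-m+N_j) and w = q^(N_j) b_j q^s. The numerator of the integrand depends only on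
y and the denominator only on w. Quasi-periodicity of theta turns the residue into C_j φ(y) ψ(w),
where φ is `saalFun` for (a, b), ψ is `saalFun` for the shifted parameters (q^M a, q^N b), and C_j
depends on neither m nor s. Since s and n = s - m + N_j are independent indices, the sum over m and
s is C_j f_j g_j. Here f_j and g_j are balanced ₃φ₂ series; φ vanishes at b_j q^n for n < 0, so both
are one-sided.

It remains to evaluate ∑ C_j f_j g_j (`sum_residueCoeff_mul`). No single f_j has a product formula,
but the q-Saalschütz summation (`saalSeries_sub`) gives each difference f_j - f_k as a product, and
likewise g_j - g_k, which is a constant multiple of f_j - f_k with the same constant for the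
differences used (`theta_shift`). The three differences of the f_j around a cycle add up to 0, which
is a three-term theta relation. With it, everything involving f_0 or g_0 cancels from the sum, and a
single product is left.

The q-Saalschütz summation is itself proved by a q-difference equation in one parameter x, solved by
iterating x to 0 and normalized at a point where one of the two series disappears and the other
terminates. -/

/-- The finite `q`-shifted factorial `(x; q)_n`. -/
def qFac (x q : ℂ) (n : ℕ) : ℂ := ∏ i ∈ range n, (1 - x * q ^ i)

theorem qFac_zero (x q : ℂ) : qFac x q 0 = 1 := by simp [qFac]

theorem qFac_succ (x q : ℂ) (n : ℕ) : qFac x q (n + 1) = qFac x q n * (1 - x * q ^ n) := by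
  simp [qFac, prod_range_succ]

theorem qFac_succ' (x q : ℂ) (n : ℕ) : qFac x q (n + 1) = (1 - x) * qFac (q * x) q n := by
  simp only [qFac, prod_range_succ', pow_zero, mul_one]
  rw [mul_comm]
  congr 1
  exact prod_congr rfl fun i _ => by ring

theorem summable_mul_pow (hq : ‖q‖ < 1) (x : ℂ) : Summable fun n : ℕ => ‖-(x * q ^ n)‖ := by
  simp only [norm_neg, norm_mul, norm_pow]
  exact (summable_geometric_of_lt_one (norm_nonneg q) hq).mul_left _

theorem multipliable_qPoch (hq : ‖q‖ < 1) (x : ℂ) : Multipliable fun n : ℕ => 1 - x * q ^ n := by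
  simpa only [sub_eq_add_neg] using multipliable_one_add_of_summable (summable_mul_pow hq x)

theorem tendsto_qFac (hq : ‖q‖ < 1) (x : ℂ) :
    Tendsto (qFac x q) atTop (𝓝 (qPoch x q)) :=
  (multipliable_qPoch hq x).hasProd.tendsto_prod_nat

theorem qPoch_eq_one_sub_mul (hq : ‖q‖ < 1) (x : ℂ) :
    qPoch x q = (1 - x) * qPoch (q * x) q := by
  have h1 : Tendsto (fun n => qFac x q (n + 1)) atTop (𝓝 (qPoch x q)) :=
    (tendsto_qFac hq x).comp (tendsto_add_atTop_nat 1)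
  refine tendsto_nhds_unique h1 ?_
  simp only [qFac_succ']
  exact (tendsto_qFac hq (q * x)).const_mul _

theorem qPoch_eq_qFac_mul (hq : ‖q‖ < 1) (x : ℂ) (n : ℕ) :
    qPoch x q = qFac x q n * qPoch (x * q ^ n) q := by
  induction n with
  | zero => simp [qFac_zero]
  | succ n ih =>
    rw [ih, qPoch_eq_one_sub_mul hq (x * q ^ n), qFac_succ]
    ring_nf

theorem qPoch_ne_zero (hq : ‖q‖ < 1) {x : ℂ} (hx : ∀ n : ℕ, x * q ^ n ≠ 1) : qPoch x q ≠ 0 := by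
  have := tprod_one_add_ne_zero_of_summable (f := fun n : ℕ => -(x * q ^ n))
    (fun n h => hx n (by linear_combination -h)) (summable_mul_pow hq x)
  simpa only [sub_eq_add_neg] using! this

theorem qPoch_eq_zero (hq : ‖q‖ < 1) {x : ℂ} {n : ℕ} (hx : x * q ^ n = 1) : qPoch x q = 0 := by
  rw [qPoch_eq_qFac_mul hq x (n + 1), qFac_succ, hx]
  simp

@[simp] theorem qPoch_zero (q : ℂ) : qPoch 0 q = 1 := by simp [qPoch]

theorem differentiable_qPoch (hq : ‖q‖ < 1) : Differentiable ℂ fun x => qPoch x q := by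
  intro x
  have hK : IsOpen (Metric.ball (0 : ℂ) (‖x‖ + 1)) := Metric.isOpen_ball
  have h := Summable.hasProdLocallyUniformlyOn_nat_one_add (R := ℂ) (f := fun (n : ℕ) (x : ℂ) => -(x * q ^ n))
    hK (u := fun n => (‖x‖ + 1) * ‖q‖ ^ n)
    ((summable_geometric_of_lt_one (norm_nonneg q) hq).mul_left _)
    (Eventually.of_forall fun n y hy => by
      rw [norm_neg, norm_mul, norm_pow]
      gcongr
      exact (mem_ball_zero_iff.1 hy).le)
    (fun n => by fun_prop)
  have h2 : DifferentiableOn ℂ (fun x => ∏' n : ℕ, (1 + -(x * q ^ n))) (Metric.ball 0 (‖x‖ + 1)) := by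
    refine TendstoLocallyUniformlyOn.differentiableOn h (Eventually.of_forall fun s => ?_) hK
    fun_prop
  have h3 := (h2 x (by simp)).differentiableAt (hK.mem_nhds (by simp))
  simpa only [qPoch, sub_eq_add_neg] using h3

theorem continuous_qPoch (hq : ‖q‖ < 1) : Continuous fun x => qPoch x q :=
  (differentiable_qPoch hq).continuous

theorem tendsto_mul_pow (hq : ‖q‖ < 1) (x : ℂ) : Tendsto (fun n : ℕ => x * q ^ n) atTop (𝓝 0) := by
  simpa using (tendsto_pow_atTop_nhds_zero_of_norm_lt_one hq).const_mul x

theorem tendsto_qPoch_mul_pow (hq : ‖q‖ < 1) (x : ℂ) :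
    Tendsto (fun n : ℕ => qPoch (x * q ^ n) q) atTop (𝓝 1) := by
  simpa [Function.comp_def] using ((continuous_qPoch hq).tendsto 0).comp (tendsto_mul_pow hq x)

/-- A bound for `(x; q)_n` that is uniform in `n`. -/
def qBound (t : ℝ) (q : ℂ) : ℝ := Real.exp (t * (1 - ‖q‖)⁻¹)

theorem norm_qFac_le (hq : ‖q‖ < 1) {x : ℂ} {t : ℝ} (hx : ‖x‖ ≤ t) (n : ℕ) :
    ‖qFac x q n‖ ≤ qBound t q := by
  calc ‖qFac x q n‖ ≤ ∏ i ∈ range n, Real.exp (t * ‖q‖ ^ i) := by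
        rw [qFac, norm_prod]
        refine prod_le_prod (fun _ _ => norm_nonneg _) fun i _ => ?_
        calc ‖1 - x * q ^ i‖ ≤ ‖(1 : ℂ)‖ + ‖x * q ^ i‖ := norm_sub_le _ _
          _ ≤ t * ‖q‖ ^ i + 1 := by
            rw [norm_one, norm_mul, norm_pow, add_comm]
            gcongr
          _ ≤ _ := Real.add_one_le_exp _
    _ = Real.exp (∑ i ∈ range n, t * ‖q‖ ^ i) := (Real.exp_sum _ _).symm
    _ ≤ qBound t q := by
      rw [qBound, ← Finset.mul_sum]
      gcongr
      · exact (norm_nonneg x).trans hx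
      · rw [← tsum_geometric_of_lt_one (norm_nonneg q) hq]
        exact (summable_geometric_of_lt_one (norm_nonneg q) hq).sum_le_tsum _
          fun _ _ => by positivity

theorem norm_qPoch_le (hq : ‖q‖ < 1) {x : ℂ} {t : ℝ} (hx : ‖x‖ ≤ t) : ‖qPoch x q‖ ≤ qBound t q :=
  le_of_tendsto (tendsto_qFac hq x).norm (Eventually.of_forall (norm_qFac_le hq hx))

/-- The theta function `(x, q / x; q)_∞`. -/
def theta (q x : ℂ) : ℂ := qPoch x q * qPoch (q / x) q

theorem theta_mul_q (hq : ‖q‖ < 1) (hq0 : q ≠ 0) {x : ℂ} (hx : x ≠ 0) :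
    theta q (q * x) = -x⁻¹ * theta q x := by
  rw [theta, theta, qPoch_eq_one_sub_mul hq x]
  rw [show q / (q * x) = x⁻¹ by field_simp, qPoch_eq_one_sub_mul hq x⁻¹,
    show q * x⁻¹ = q / x by ring]
  field_simp
  ring

theorem theta_inv (hq : ‖q‖ < 1) {x : ℂ} (hx : x ≠ 0) :
    theta q x⁻¹ = -x⁻¹ * theta q x := by
  rw [theta, theta, qPoch_eq_one_sub_mul hq x, qPoch_eq_one_sub_mul hq x⁻¹]
  simp only [div_eq_mul_inv]
  field_simp
  ring

/-- Quasi-periodicity of the theta function, in terms of a square root `r` of `q`. -/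
theorem theta_zpow_mul {r : ℂ} (hq : ‖q‖ < 1) (hr0 : r ≠ 0) (hr : r ^ 2 = q) (n : ℤ) {x : ℂ}
    (hx : x ≠ 0) :
    theta q (q ^ n * x) = (-1) ^ n * x ^ (-n) * r ^ (n - n ^ 2) * theta q x := by
  have hq0 : q ≠ 0 := by rw [← hr]; positivity
  -- Both sides satisfy the same first-order recurrence in n with a nonzero multiplier, so the
  -- induction can run in both directions.
  have step : ∀ n : ℤ, theta q (q ^ (n + 1) * x) = -(q ^ n * x)⁻¹ * theta q (q ^ n * x) := by
    intro n
    rw [← theta_mul_q hq hq0 (by positivity), zpow_add_one₀ hq0]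
    ring_nf
  have step2 : ∀ n : ℤ, (-1) ^ (n + 1) * x ^ (-(n + 1)) * r ^ ((n + 1) - (n + 1) ^ 2) * theta q x =
      -(q ^ n * x)⁻¹ * ((-1) ^ n * x ^ (-n) * r ^ (n - n ^ 2) * theta q x) := by
    intro n
    rw [← hr, show (n + 1) - (n + 1) ^ 2 = (n - n ^ 2) + -(2 * n) by ring, neg_add,
      zpow_add₀ hr0, zpow_add₀ hx, zpow_add₀ (by norm_num : (-1 : ℂ) ≠ 0), zpow_neg r, zpow_mul]
    norm_cast
    push_cast
    simp only [zpow_neg, zpow_one, mul_inv]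
    ring
  induction n using Int.induction_on with
  | zero => simp
  | succ n ih => rw [step, ih, step2]
  | pred n ih =>
    have h1 := step (-(n : ℤ) - 1)
    have h2 := step2 (-(n : ℤ) - 1)
    rw [sub_add_cancel] at h1 h2
    rw [ih, h2] at h1
    have h3 : -(q ^ (-(n : ℤ) - 1) * x)⁻¹ ≠ 0 := by
      rw [neg_ne_zero]; positivity
    exact (mul_left_cancel₀ h3 h1).symm

end SQED

end

/-! ### The nonterminating q-Saalschütz summation -/

noncomputable section

namespace SQED

open Filter Topology Finset

variable {q : ℂ}

/-- The terms of a nonterminating balanced `₃φ₂` series with argument `q`, up to normalization. -/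
def saalTerm (q u v α β x : ℂ) (n : ℕ) : ℂ :=
  u * q ^ n * (qPoch (q * (u * q ^ n) / u) q * qPoch (q * (u * q ^ n) / v) q *
    qPoch (α * β * u * v * x * (u * q ^ n)) q) *
    ((qPoch (α * (u * q ^ n)) q)⁻¹ * (qPoch (β * (u * q ^ n)) q)⁻¹) * qFac (x * u) q n

/-- The partial sums of the series in the contiguous relation for `saalTerm`. -/
def saalSum (q u v α β x : ℂ) (n : ℕ) : ℂ :=
  -(x * u * v) * (qPoch (q * (u * q ^ n) / u) q * qPoch (q * (u * q ^ n) / v) q *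
    qPoch (α * β * u * v * x * (q * (u * q ^ n))) q) *
    ((qPoch (α * (q * (u * q ^ n))) q)⁻¹ * (qPoch (β * (q * (u * q ^ n))) q)⁻¹) *
    qFac (q * x * u) q n

/-- The inverses converge to 1, hence are bounded. Indices where the product vanishes do no harm,
because the inverse of 0 is 0. -/
theorem bounded_inv_qPoch (hq : ‖q‖ < 1) (c : ℂ) :
    ∃ C, ∀ n : ℕ, ‖(qPoch (c * q ^ n) q)⁻¹‖ ≤ C := by
  have h := (tendsto_qPoch_mul_pow hq c).inv₀ one_ne_zero
  obtain ⟨C, hC⟩ := (Metric.isBounded_range_of_tendsto _ h).exists_norm_le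
  exact ⟨C, fun n => hC _ ⟨n, rfl⟩⟩

/-- The parameter x occurs only in numerators, so the bound is uniform on discs in x. This gives
dominated convergence when x tends to 0. -/
theorem norm_saalTerm_le (hq : ‖q‖ < 1) (u v α β : ℂ) (t : ℝ) :
    ∃ C, ∀ x : ℂ, ‖x‖ ≤ t → ∀ n, ‖saalTerm q u v α β x n‖ ≤ C * ‖q‖ ^ n := by
  obtain ⟨Ca, hCa⟩ := bounded_inv_qPoch hq (α * u)
  obtain ⟨Cb, hCb⟩ := bounded_inv_qPoch hq (β * u)
  refine ⟨‖u‖ * (qBound ‖q * u / u‖ q * qBound ‖q * u / v‖ q * qBound ‖α * β * u * v * t * u‖ q) *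
    (Ca * Cb) * qBound ‖t * u‖ q, fun x hx n => ?_⟩
  have ht : 0 ≤ t := (norm_nonneg x).trans hx
  have hqn : ‖q ^ n‖ ≤ 1 := by
    rw [norm_pow]; exact pow_le_one₀ (norm_nonneg _) hq.le
  have key : ∀ w : ℂ, ‖w * q ^ n‖ ≤ ‖w‖ := fun w => by
    rw [norm_mul]; exact mul_le_of_le_one_right (norm_nonneg _) hqn
  have h1 : ‖qPoch (q * (u * q ^ n) / u) q‖ ≤ qBound ‖q * u / u‖ q :=
    norm_qPoch_le hq (by convert key (q * u / u) using 2; ring)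
  have h2 : ‖qPoch (q * (u * q ^ n) / v) q‖ ≤ qBound ‖q * u / v‖ q :=
    norm_qPoch_le hq (by convert key (q * u / v) using 2; ring)
  have h3 : ‖qPoch (α * β * u * v * x * (u * q ^ n)) q‖ ≤ qBound ‖α * β * u * v * t * u‖ q := by
    refine norm_qPoch_le hq ?_
    rw [← mul_assoc]
    refine (key _).trans ?_
    simp only [norm_mul, Complex.norm_real, Real.norm_of_nonneg ht]
    gcongr
  have h4 : ‖qFac (x * u) q n‖ ≤ qBound ‖t * u‖ q := by
    refine norm_qFac_le hq ?_ n
    simp only [norm_mul, Complex.norm_real, Real.norm_of_nonneg ht]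
    gcongr
  have h5 := hCa n
  have h6 := hCb n
  rw [mul_assoc] at h5 h6
  have hB : ∀ t, 0 ≤ qBound t q := fun t => (Real.exp_pos _).le
  have hCa0 : 0 ≤ Ca := (norm_nonneg _).trans h5
  have hCb0 : 0 ≤ Cb := (norm_nonneg _).trans h6
  have hB1 := hB ‖q * u / u‖
  have hB2 := hB ‖q * u / v‖
  have hB3 := hB ‖α * β * u * v * t * u‖
  have hB4 := hB ‖t * u‖
  rw [saalTerm]
  simp only [norm_mul] at *
  calc _ ≤ ‖u‖ * ‖q ^ n‖ * (qBound (‖q * u / u‖) q * qBound ‖q * u / v‖ q *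
        qBound ‖α * β * u * v * t * u‖ q) * (Ca * Cb) * qBound ‖t * u‖ q := by
        simp only [norm_mul]
        gcongr
    _ = _ := by simp only [norm_mul, norm_pow]; ring

theorem summable_saalTerm (hq : ‖q‖ < 1) (u v α β x : ℂ) : Summable (saalTerm q u v α β x) := by
  obtain ⟨C, hC⟩ := norm_saalTerm_le hq u v α β ‖x‖
  exact Summable.of_norm_bounded
    ((summable_geometric_of_lt_one (norm_nonneg q) hq).mul_left C) (hC x le_rfl)

theorem tendsto_saalSum (hq : ‖q‖ < 1) (u v α β x : ℂ) :
    Tendsto (saalSum q u v α β x) atTop (𝓝 (-(x * u * v) * qPoch (q * x * u) q)) := by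
  have h : ∀ c : ℂ, Tendsto (fun n : ℕ => qPoch (c * q ^ n) q) atTop (𝓝 1) :=
    tendsto_qPoch_mul_pow hq
  have := ((((h (q * u / u)).mul (h (q * u / v))).mul
    (h (α * β * u * v * x * (q * u)))).const_mul (-(x * u * v))).mul
    (((h (α * (q * u))).inv₀ one_ne_zero).mul ((h (β * (q * u))).inv₀ one_ne_zero)) |>.mul
    (tendsto_qFac hq (q * x * u))
  simp only [mul_one, inv_one] at this
  refine this.congr fun n => ?_
  rw [saalSum]
  ring_nf

theorem saalTerm_contiguous_zero (hq : ‖q‖ < 1) {u v α β x : ℂ} (hu : u ≠ 0)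
    (hα : ∀ n : ℕ, α * (u * q ^ n) ≠ 1) (hβ : ∀ n : ℕ, β * (u * q ^ n) ≠ 1) :
    (1 - x * v) * saalTerm q u v α β x 0 -
      (1 - x * α * u * v) * (1 - x * β * u * v) * saalTerm q u v α β (q * x) 0 =
      saalSum q u v α β x 0 := by
  have hα' : qPoch (α * u) q ≠ 0 := qPoch_ne_zero hq fun n => by rw [mul_assoc]; exact hα n
  have hβ' : qPoch (β * u) q ≠ 0 := qPoch_ne_zero hq fun n => by rw [mul_assoc]; exact hβ n
  rw [qPoch_eq_one_sub_mul hq] at hα' hβ'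
  have h1 := left_ne_zero_of_mul hα'
  have h2 := right_ne_zero_of_mul hα'
  have h3 := left_ne_zero_of_mul hβ'
  have h4 := right_ne_zero_of_mul hβ'
  simp only [saalTerm, saalSum, pow_zero, mul_one, qFac_zero]
  rw [qPoch_eq_one_sub_mul hq (α * u), qPoch_eq_one_sub_mul hq (β * u),
    qPoch_eq_one_sub_mul hq (α * β * u * v * x * u),
    show α * β * u * v * (q * x) * u = q * (α * β * u * v * x * u) by ring,
    show α * β * u * v * x * (q * u) = q * (α * β * u * v * x * u) by ring,
    show α * (q * u) = q * (α * u) by ring, show β * (q * u) = q * (β * u) by ring]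
  generalize qPoch (q * u / u) q = A at *
  generalize qPoch (q * u / v) q = B at *
  generalize qPoch (q * (α * u)) q = C at *
  generalize qPoch (q * (β * u)) q = D at *
  generalize qPoch (q * (α * β * u * v * x * u)) q = E at *
  obtain ⟨a, ha⟩ : ∃ a, a = 1 - α * u := ⟨_, rfl⟩
  obtain ⟨b, hb⟩ : ∃ b, b = 1 - β * u := ⟨_, rfl⟩
  rw [← ha] at h1
  rw [← hb] at h3
  rw [← ha, ← hb]
  field_simp
  rw [ha, hb]
  ring

/-- A telescoping certificate: the combination of terms at x and at q x that eliminates the series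
is a difference of consecutive values of `saalSum`. After the factors common to both sides are split
off, it is a rational function identity in z = u q^(n+1). -/
theorem saalTerm_contiguous_succ (hq : ‖q‖ < 1) {u v α β x : ℂ} (hu : u ≠ 0) (hv : v ≠ 0)
    (hα : ∀ n : ℕ, α * (u * q ^ n) ≠ 1) (hβ : ∀ n : ℕ, β * (u * q ^ n) ≠ 1) (n : ℕ) :
    (1 - x * v) * saalTerm q u v α β x (n + 1) -
      (1 - x * α * u * v) * (1 - x * β * u * v) * saalTerm q u v α β (q * x) (n + 1) =
      saalSum q u v α β x (n + 1) - saalSum q u v α β x n := by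
  have hα' : qPoch (α * (u * q ^ (n + 1))) q ≠ 0 := qPoch_ne_zero hq fun k => by
    convert hα (n + 1 + k) using 1; ring
  have hβ' : qPoch (β * (u * q ^ (n + 1))) q ≠ 0 := qPoch_ne_zero hq fun k => by
    convert hβ (n + 1 + k) using 1; ring
  simp only [saalTerm, saalSum]
  rw [show q * (u * q ^ n) = u * q ^ (n + 1) by ring, qFac_succ' (x * u),
    show q * (x * u) = q * x * u by ring, qFac_succ (q * x * u),
    show q * x * u * q ^ n = x * (u * q ^ (n + 1)) by ring]
  generalize u * q ^ (n + 1) = z at *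
  rw [qPoch_eq_one_sub_mul hq] at hα' hβ'
  have h1 := left_ne_zero_of_mul hα'
  have h2 := right_ne_zero_of_mul hα'
  have h3 := left_ne_zero_of_mul hβ'
  have h4 := right_ne_zero_of_mul hβ'
  rw [qPoch_eq_one_sub_mul hq (α * z), qPoch_eq_one_sub_mul hq (β * z),
    qPoch_eq_one_sub_mul hq (α * β * u * v * x * z),
    qPoch_eq_one_sub_mul hq (z / u), qPoch_eq_one_sub_mul hq (z / v),
    show α * β * u * v * (q * x) * z = q * (α * β * u * v * x * z) by ring,
    show α * β * u * v * x * (q * z) = q * (α * β * u * v * x * z) by ring,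
    show α * (q * z) = q * (α * z) by ring, show β * (q * z) = q * (β * z) by ring,
    ← mul_div_assoc, ← mul_div_assoc]
  generalize qPoch (q * z / u) q = A at *
  generalize qPoch (q * z / v) q = B at *
  generalize qPoch (q * (α * z)) q = C at *
  generalize qPoch (q * (β * z)) q = D at *
  generalize qPoch (q * (α * β * u * v * x * z)) q = E at *
  generalize qFac (q * x * u) q n = F at *
  obtain ⟨a, ha⟩ : ∃ a, a = 1 - α * z := ⟨_, rfl⟩
  obtain ⟨b, hb⟩ : ∃ b, b = 1 - β * z := ⟨_, rfl⟩
  rw [← ha] at h1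
  rw [← hb] at h3
  rw [← ha, ← hb]
  field_simp
  rw [ha, hb]
  ring

/-- The telescoped sums converge to the limit of `saalSum`, which leaves an inhomogeneous
first-order q-difference equation in x. -/
theorem tsum_saalTerm_contiguous (hq : ‖q‖ < 1) {u v α β : ℂ} (x : ℂ) (hu : u ≠ 0) (hv : v ≠ 0)
    (hα : ∀ n : ℕ, α * (u * q ^ n) ≠ 1) (hβ : ∀ n : ℕ, β * (u * q ^ n) ≠ 1) :
    (1 - x * v) * ∑' n, saalTerm q u v α β x n -
      (1 - x * α * u * v) * (1 - x * β * u * v) * ∑' n, saalTerm q u v α β (q * x) n =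
      -(x * u * v) * qPoch (q * x * u) q := by
  have h := ((summable_saalTerm hq u v α β x).hasSum.mul_left (1 - x * v)).sub
    ((summable_saalTerm hq u v α β (q * x)).hasSum.mul_left
      ((1 - x * α * u * v) * (1 - x * β * u * v)))
  refine tendsto_nhds_unique (h.tendsto_sum_nat.comp (tendsto_add_atTop_nat 1)) ?_
  refine (tendsto_saalSum hq u v α β x).congr fun n => ?_
  induction n with
  | zero => simp [← saalTerm_contiguous_zero hq hu hα hβ]
  | succ n ih =>
    have := saalTerm_contiguous_succ hq (x := x) hu hv hα hβ n
    simp only [Function.comp] at ih ⊢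
    rw [sum_range_succ, ← ih, this]
    ring

/-- The difference of two nonterminating balanced `₃φ₂` series, suitably normalized. -/
def saalDiff (q u v α β x : ℂ) : ℂ :=
  qPoch (x * v) q * ∑' n, saalTerm q u v α β x n - qPoch (x * u) q * ∑' n, saalTerm q v u α β x n

/-- Multiplied by (q x v; q)_∞ and (q x u; q)_∞ respectively, the inhomogeneous terms of the two
contiguous relations coincide and cancel in the difference. The equation becomes homogeneous. -/
theorem saalDiff_step (hq : ‖q‖ < 1) {u v α β : ℂ} (x : ℂ) (hu : u ≠ 0) (hv : v ≠ 0)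
    (hαu : ∀ n : ℕ, α * (u * q ^ n) ≠ 1) (hβu : ∀ n : ℕ, β * (u * q ^ n) ≠ 1)
    (hαv : ∀ n : ℕ, α * (v * q ^ n) ≠ 1) (hβv : ∀ n : ℕ, β * (v * q ^ n) ≠ 1) :
    saalDiff q u v α β x =
      (1 - x * α * u * v) * (1 - x * β * u * v) * saalDiff q u v α β (q * x) := by
  have h1 := tsum_saalTerm_contiguous hq x hu hv hαu hβu
  have h2 := tsum_saalTerm_contiguous hq x hv hu hαv hβv
  simp only [saalDiff]
  rw [qPoch_eq_one_sub_mul hq (x * u), qPoch_eq_one_sub_mul hq (x * v),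
    ← mul_assoc q x, ← mul_assoc q x]
  linear_combination qPoch (q * x * v) q * h1 - qPoch (q * x * u) q * h2

/-- Iterate the homogeneous equation along x q^n and let n tend to infinity; the finite products
become infinite ones and the series pass to the limit by dominated convergence. -/
theorem saalDiff_eq_mul_zero (hq : ‖q‖ < 1) {u v α β : ℂ} (x : ℂ) (hu : u ≠ 0) (hv : v ≠ 0)
    (hαu : ∀ n : ℕ, α * (u * q ^ n) ≠ 1) (hβu : ∀ n : ℕ, β * (u * q ^ n) ≠ 1)
    (hαv : ∀ n : ℕ, α * (v * q ^ n) ≠ 1) (hβv : ∀ n : ℕ, β * (v * q ^ n) ≠ 1) :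
    saalDiff q u v α β x =
      qPoch (x * α * u * v) q * qPoch (x * β * u * v) q * saalDiff q u v α β 0 := by
  have hiter : ∀ n : ℕ, saalDiff q u v α β x =
      qFac (x * α * u * v) q n * qFac (x * β * u * v) q n * saalDiff q u v α β (x * q ^ n) := by
    intro n
    induction n with
    | zero => simp [qFac_zero]
    | succ n ih =>
      rw [ih, saalDiff_step hq _ hu hv hαu hβu hαv hβv, qFac_succ, qFac_succ]
      ring_nf
  have hlim : ∀ u v : ℂ, Tendsto (fun n : ℕ => ∑' k, saalTerm q u v α β (x * q ^ n) k) atTop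
      (𝓝 (∑' k, saalTerm q u v α β 0 k)) := by
    intro u v
    obtain ⟨C, hC⟩ := norm_saalTerm_le hq u v α β ‖x‖
    refine tendsto_tsum_of_dominated_convergence (bound := fun k => C * ‖q‖ ^ k)
      ((summable_geometric_of_lt_one (norm_nonneg q) hq).mul_left C) (fun k => ?_)
      (Eventually.of_forall fun n k => hC _ ?_ k)
    · have hc : Continuous fun y => saalTerm q u v α β y k := by
        have := continuous_qPoch hq
        unfold saalTerm qFac
        fun_prop
      exact (hc.tendsto 0).comp (tendsto_mul_pow hq x)
    · rw [norm_mul, norm_pow]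
      exact mul_le_of_le_one_right (norm_nonneg _) (pow_le_one₀ (norm_nonneg _) hq.le)
  have hlim2 : ∀ u : ℂ, Tendsto (fun n : ℕ => qPoch (x * q ^ n * u) q) atTop
      (𝓝 (qPoch (0 * u) q)) := fun u =>
    ((continuous_qPoch hq).tendsto _).comp ((tendsto_mul_pow hq x).mul_const u)
  refine tendsto_nhds_unique (f := fun _ : ℕ => saalDiff q u v α β x) (l := atTop)
    tendsto_const_nhds ?_
  have := ((tendsto_qFac hq (x * α * u * v)).mul (tendsto_qFac hq (x * β * u * v))).mul
    (((hlim2 v).mul (hlim u v)).sub ((hlim2 u).mul (hlim v u)))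
  exact this.congr fun n => (hiter n).symm

/-- At x = 1/v the prefactor (x v; q)_∞ of the first series is 0, and (x v; q)_n kills every term
but n = 0 of the second. This explicit value fixes the unknown constant `saalDiff q u v α β 0`. -/
theorem saalDiff_inv (hq : ‖q‖ < 1) {u v α β : ℂ} (hv : v ≠ 0) :
    saalDiff q u v α β v⁻¹ = -(v * qPoch q q * qPoch (q * v / u) q * qPoch (u / v) q *
      qPoch (α * β * u * v) q * ((qPoch (α * v) q)⁻¹ * (qPoch (β * v) q)⁻¹)) := by
  have h1 : qPoch (v⁻¹ * v) q = 0 := qPoch_eq_zero hq (n := 0) (by simp [hv])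
  have h2 : ∀ n ≠ 0, saalTerm q v u α β v⁻¹ n = 0 := by
    intro n hn
    obtain ⟨k, rfl⟩ := Nat.exists_eq_succ_of_ne_zero hn
    rw [saalTerm, Nat.succ_eq_add_one, qFac_succ', inv_mul_cancel₀ hv]
    simp
  rw [saalDiff, h1, tsum_eq_single 0 h2, saalTerm, qFac_zero]
  simp only [pow_zero, mul_one]
  rw [show q * v / v = q by field_simp, show α * β * v * u * v⁻¹ * v = α * β * u * v by field_simp,
    show v⁻¹ * u = u / v by ring]
  ring

/-- The nonterminating `q`-Saalschütz summation in normalized form. -/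
theorem saalDiff_eq (hq : ‖q‖ < 1) {u v α β : ℂ} (x : ℂ) (hu : u ≠ 0) (hv : v ≠ 0)
    (hαu : ∀ n : ℕ, α * (u * q ^ n) ≠ 1) (hβu : ∀ n : ℕ, β * (u * q ^ n) ≠ 1)
    (hαv : ∀ n : ℕ, α * (v * q ^ n) ≠ 1) (hβv : ∀ n : ℕ, β * (v * q ^ n) ≠ 1) :
    saalDiff q u v α β x = -(v * qPoch q q * qPoch (q * v / u) q * qPoch (u / v) q *
      (qPoch (α * β * u * v) q * qPoch (x * α * u * v) q * qPoch (x * β * u * v) q) /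
      (qPoch (α * u) q * qPoch (α * v) q * (qPoch (β * u) q * qPoch (β * v) q))) := by
  have h1 := saalDiff_eq_mul_zero hq v⁻¹ hu hv hαu hβu hαv hβv
  rw [saalDiff_inv hq hv, show v⁻¹ * α * u * v = α * u by field_simp,
    show v⁻¹ * β * u * v = β * u by field_simp] at h1
  have hne : ∀ c w : ℂ, (∀ n : ℕ, c * (w * q ^ n) ≠ 1) → qPoch (c * w) q ≠ 0 := fun c w h =>
    qPoch_ne_zero hq fun n => by rw [mul_assoc]; exact h n
  have e1 := hne _ _ hαu
  have e2 := hne _ _ hβu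
  have e3 := hne _ _ hαv
  have e4 := hne _ _ hβv
  rw [saalDiff_eq_mul_zero hq x hu hv hαu hβu hαv hβv]
  generalize qPoch (α * u) q = A at *
  generalize qPoch (β * u) q = B at *
  generalize qPoch (α * v) q = C at *
  generalize qPoch (β * v) q = D at *
  have h2 : saalDiff q u v α β 0 = -(v * qPoch q q * qPoch (q * v / u) q * qPoch (u / v) q *
      qPoch (α * β * u * v) q * (C⁻¹ * D⁻¹)) * (A⁻¹ * B⁻¹) := by
    rw [h1]
    field_simp
  rw [h2]
  ring

end SQED

end

/-! ### The summation in symmetric parameters -/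

noncomputable section

namespace SQED

open Filter Topology Finset

variable {q r : ℂ}

theorem prod_fin_three_of_ne {M : Type*} [CommMonoid M] (f : Fin 3 → M) {j k l : Fin 3}
    (hjk : j ≠ k) (hkl : k ≠ l) (hlj : l ≠ j) : ∏ i, f i = f j * f k * f l := by
  have h : (univ : Finset (Fin 3)) = {j, k, l} := by
    revert j k l; decide
  rw [h, prod_insert (by simp [hjk, hlj.symm]), prod_insert (by simp [hkl]), prod_singleton,
    mul_assoc]

theorem sum_fin_three_of_ne {M : Type*} [AddCommMonoid M] (f : Fin 3 → M) {j k l : Fin 3}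
    (hjk : j ≠ k) (hkl : k ≠ l) (hlj : l ≠ j) : ∑ i, f i = f j + f k + f l :=
  prod_fin_three_of_ne (M := Multiplicative M) f hjk hkl hlj

/-- Genericity is a condition modulo integer powers of q, so all results for (a, b) apply to the
shifted parameters as well. -/
theorem IsGeneric.shift {a b : Fin 3 → ℂ} (hq0 : q ≠ 0) (h : IsGeneric q a b) (M N : Fin 3 → ℤ) :
    IsGeneric q (fun i => q ^ M i * a i) (fun i => q ^ N i * b i) where
  mul_ne j k n hn := h.mul_ne j k (n - M j - N k) (by
    rw [zpow_sub₀ hq0, zpow_sub₀ hq0, ← hn]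
    field_simp)
  left_ne j k n hjk hn := h.left_ne j k (n + M k - M j) hjk (by
    rw [zpow_sub₀ hq0, zpow_add₀ hq0]
    field_simp
    linear_combination hn)
  right_ne j k n hjk hn := h.right_ne j k (n + N k - N j) hjk (by
    rw [zpow_sub₀ hq0, zpow_add₀ hq0]
    field_simp
    linear_combination hn)

theorem qPoch_zpow_mul_ne_zero (hq : ‖q‖ < 1) (hq0 : q ≠ 0) {x : ℂ} (hx : ∀ n : ℤ, x ≠ q ^ n)
    (m : ℤ) : qPoch (q ^ m * x) q ≠ 0 := by
  refine qPoch_ne_zero hq fun n h => hx (-m - n) ?_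
  rw [zpow_sub₀ hq0, zpow_neg, zpow_natCast]
  field_simp
  linear_combination h

theorem qPoch_ne_zero_of_ne_zpow (hq : ‖q‖ < 1) (hq0 : q ≠ 0) {x : ℂ} (hx : ∀ n : ℤ, x ≠ q ^ n) :
    qPoch x q ≠ 0 := by
  simpa using qPoch_zpow_mul_ne_zero hq hq0 hx 0

theorem theta_ne_zero (hq : ‖q‖ < 1) (hq0 : q ≠ 0) {x : ℂ} (hx : ∀ n : ℤ, x ≠ q ^ n) :
    theta q x ≠ 0 := by
  refine mul_ne_zero (qPoch_ne_zero_of_ne_zpow hq hq0 hx) ?_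
  refine qPoch_ne_zero_of_ne_zpow hq hq0 fun n h => hx (1 - n) ?_
  have hx0 : x ≠ 0 := by
    rintro rfl
    exact zpow_ne_zero n hq0 (by rw [← h, div_zero])
  rw [zpow_sub₀ hq0, zpow_one, ← h]
  field_simp

/-- The function whose values along the sequences `b_j q^n` are the terms of the series
`saalSeries`. -/
def saalFun (q : ℂ) (a b : Fin 3 → ℂ) (z : ℂ) : ℂ :=
  z * ∏ i, qPoch (q * z / b i) q / qPoch (a i * z) q

/-- A nonterminating `₃φ₂` series with argument `q`, up to normalization. -/
def saalSeries (q : ℂ) (a b : Fin 3 → ℂ) (j : Fin 3) : ℂ := ∑' n : ℕ, saalFun q a b (b j * q ^ n)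

/-- The balancing condition makes α β u v x equal to q / b_l, which brings in the third parameter
b_l. The finite factor (a_0 b_j; q)_n is (a_0 b_j; q)_∞ divided by its tail, and this yields the
missing denominator. -/
theorem saalTerm_eq_saalFun (hq : ‖q‖ < 1) {a b : Fin 3 → ℂ}
    (hab : (∏ i, a i) * ∏ i, b i = q) (hb0 : ∀ i, b i ≠ 0)
    {j k l : Fin 3} (hjk : j ≠ k) (hkl : k ≠ l) (hlj : l ≠ j)
    (h0 : qPoch (a 0 * b j) q ≠ 0) (n : ℕ) :
    saalTerm q (b j) (b k) (a 1) (a 2) (a 0) n =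
      qPoch (a 0 * b j) q * saalFun q a b (b j * q ^ n) := by
  rw [saalFun, prod_div_distrib, prod_fin_three_of_ne (fun i => qPoch (q * (b j * q ^ n) / b i) q)
    hjk hkl hlj, Fin.prod_univ_three, saalTerm]
  rw [prod_fin_three_of_ne b hjk hkl hlj, Fin.prod_univ_three] at hab
  have hl := hb0 l
  rw [show a 1 * a 2 * b j * b k * a 0 * (b j * q ^ n) = q * (b j * q ^ n) / b l by
    rw [eq_div_iff hl, ← hab]; ring]
  rw [qPoch_eq_qFac_mul hq (a 0 * b j) n] at h0 ⊢
  rw [show a 0 * (b j * q ^ n) = a 0 * b j * q ^ n by ring]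
  generalize qPoch (a 0 * b j * q ^ n) q = A at *
  have hA := right_ne_zero_of_mul h0
  have : A * A⁻¹ = 1 := mul_inv_cancel₀ hA
  simp only [div_eq_mul_inv, mul_inv]
  linear_combination (-b j * q ^ n * qPoch (q * (b j * q ^ n) * (b j)⁻¹) q *
    qPoch (q * (b j * q ^ n) * (b k)⁻¹) q * qPoch (q * (b j * q ^ n) * (b l)⁻¹) q *
    (qPoch (a 1 * (b j * q ^ n)) q)⁻¹ * (qPoch (a 2 * (b j * q ^ n)) q)⁻¹ *
    qFac (a 0 * b j) q n) * this

theorem summable_saalFun (hq : ‖q‖ < 1) {a b : Fin 3 → ℂ}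
    (hab : (∏ i, a i) * ∏ i, b i = q) (hb0 : ∀ i, b i ≠ 0)
    (j : Fin 3) (h0 : qPoch (a 0 * b j) q ≠ 0) :
    Summable fun n : ℕ => saalFun q a b (b j * q ^ n) := by
  obtain ⟨k, l, hjk, hkl, hlj⟩ : ∃ k l : Fin 3, j ≠ k ∧ k ≠ l ∧ l ≠ j := by
    clear h0; decide +revert
  have h := summable_saalTerm hq (b j) (b k) (a 1) (a 2) (a 0)
  simp only [funext (saalTerm_eq_saalFun hq hab hb0 hjk hkl hlj h0)] at h
  exact (summable_mul_left_iff h0).1 h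

/-- The nonterminating `q`-Saalschütz summation. -/
theorem saalSeries_sub (hq : ‖q‖ < 1) (hq0 : q ≠ 0) {a b : Fin 3 → ℂ}
    (hab : (∏ i, a i) * ∏ i, b i = q) (h : IsGeneric q a b)
    {j k l : Fin 3} (hjk : j ≠ k) (hkl : k ≠ l) (hlj : l ≠ j) :
    saalSeries q a b j - saalSeries q a b k =
      -(b k * theta q (b j / b k) * qPoch q q * ∏ i, theta q (a i * b l)) /
        ∏ i, ∏ j, qPoch (a i * b j) q := by
  have ha0 : ∀ i, a i ≠ 0 := fun i hi => hq0 (by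
    rw [← hab, prod_eq_zero (mem_univ i) hi, zero_mul])
  have hb0 : ∀ i, b i ≠ 0 := fun i hi => hq0 (by
    rw [← hab, prod_eq_zero (mem_univ i) hi, mul_zero])
  have hne : ∀ i j, qPoch (a i * b j) q ≠ 0 := fun i j =>
    qPoch_ne_zero_of_ne_zpow hq hq0 (h.mul_ne i j)
  have hne1 : ∀ i j (n : ℕ), a i * (b j * q ^ n) ≠ 1 := fun i j n hn => h.mul_ne i j (-n) (by
    rw [zpow_neg, zpow_natCast]
    exact eq_inv_of_mul_eq_one_left (by rw [← hn]; ring))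
  -- The asymmetric form is used with x = a_0, α = a_1, β = a_2, u = b_j, v = b_k. Balancing then
  -- rewrites its three products on the right as (q / (a_i b_l); q)_∞, which are halves of theta
  -- functions.
  have key := saalDiff_eq hq (a 0) (hb0 j) (hb0 k) (hne1 1 j) (hne1 2 j) (hne1 1 k) (hne1 2 k)
  have e1 : ∑' n, saalTerm q (b j) (b k) (a 1) (a 2) (a 0) n =
      qPoch (a 0 * b j) q * saalSeries q a b j := by
    simp only [funext (saalTerm_eq_saalFun hq hab hb0 hjk hkl hlj (hne 0 j)), saalSeries,
      tsum_mul_left]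
  have e2 : ∑' n, saalTerm q (b k) (b j) (a 1) (a 2) (a 0) n =
      qPoch (a 0 * b k) q * saalSeries q a b k := by
    simp only [funext (saalTerm_eq_saalFun hq hab hb0 hjk.symm hlj.symm hkl.symm (hne 0 k)),
      saalSeries, tsum_mul_left]
  have hab' := hab
  rw [prod_fin_three_of_ne b hjk hkl hlj, Fin.prod_univ_three] at hab'
  rw [saalDiff, e1, e2,
    show a 1 * a 2 * b j * b k = q / (a 0 * b l) by
      rw [eq_div_iff (mul_ne_zero (ha0 0) (hb0 l)), ← hab']; ring,
    show a 0 * a 1 * b j * b k = q / (a 2 * b l) by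
      rw [eq_div_iff (mul_ne_zero (ha0 2) (hb0 l)), ← hab']; ring,
    show a 0 * a 2 * b j * b k = q / (a 1 * b l) by
      rw [eq_div_iff (mul_ne_zero (ha0 1) (hb0 l)), ← hab']; ring] at key
  have hP : ∏ i, ∏ j, qPoch (a i * b j) q =
      (qPoch (a 0 * b j) q * qPoch (a 0 * b k) q * qPoch (a 0 * b l) q) *
      (qPoch (a 1 * b j) q * qPoch (a 1 * b k) q * qPoch (a 1 * b l) q) *
      (qPoch (a 2 * b j) q * qPoch (a 2 * b k) q * qPoch (a 2 * b l) q) := by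
    rw [Fin.prod_univ_three]
    congr 1
    · congr 1 <;> exact prod_fin_three_of_ne _ hjk hkl hlj
    · exact prod_fin_three_of_ne _ hjk hkl hlj
  rw [hP, Fin.prod_univ_three]
  simp only [theta, div_div_eq_mul_div]
  have g0j := hne 0 j
  have g0k := hne 0 k
  have g0l := hne 0 l
  have g1j := hne 1 j
  have g1k := hne 1 k
  have g1l := hne 1 l
  have g2j := hne 2 j
  have g2k := hne 2 k
  have g2l := hne 2 l
  rw [eq_div_iff (by positivity)]
  generalize qPoch (a 0 * b j) q = A0j at *
  generalize qPoch (a 0 * b k) q = A0k at *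
  generalize qPoch (a 0 * b l) q = A0l at *
  generalize qPoch (a 1 * b j) q = A1j at *
  generalize qPoch (a 1 * b k) q = A1k at *
  generalize qPoch (a 1 * b l) q = A1l at *
  generalize qPoch (a 2 * b j) q = A2j at *
  generalize qPoch (a 2 * b k) q = A2k at *
  generalize qPoch (a 2 * b l) q = A2l at *
  rw [← neg_div, eq_div_iff (by positivity)] at key
  linear_combination A0l * A1l * A2l * key

end SQED

end

/-! ### Factorization of the residues and evaluation of their sum -/

noncomputable section

namespace SQED

open Filter Topology Finset

variable {q r : ℂ}

/-- Logarithms compatible with the product condition: the last one is defined by subtraction, not as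
a principal value. Monomial identities can then be checked as polynomial identities between
exponents, modulo 2πi. -/
theorem exists_exp_eq_of_prod_eq {a : Fin 3 → ℂ} {ρ : ℂ} (ha : ∏ i, a i = Complex.exp ρ) :
    ∃ α : Fin 3 → ℂ, (∀ i, a i = Complex.exp (α i)) ∧ ∑ i, α i = ρ := by
  have h0 : ∀ i, a i ≠ 0 := fun i hi => Complex.exp_ne_zero ρ (by
    rw [← ha, prod_eq_zero (mem_univ i) hi])
  refine ⟨![Complex.log (a 0), Complex.log (a 1), ρ - Complex.log (a 0) - Complex.log (a 1)],
    fun i => ?_, by simp [Fin.sum_univ_three]⟩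
  have h0' := h0 0
  have h1' := h0 1
  fin_cases i
  · simp [Complex.exp_log h0']
  · simp [Complex.exp_log h1']
  · simp only [Fin.prod_univ_three] at ha
    simp [Complex.exp_sub, Complex.exp_log h0', Complex.exp_log h1', ← ha]
    field_simp

/-- The factor by which the differences of the series change under integer shifts. -/
def shiftFactor (r : ℂ) (a b : Fin 3 → ℂ) (M N : Fin 3 → ℤ) : ℂ :=
  r ^ (-∑ i, (M i ^ 2 + 2 * N i ^ 2)) * ∏ i, (a i ^ (-M i) * b i ^ (-2 * N i))

/-- The theta products in the q-Saalschütz formula change under integer shifts by a factor that does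
not depend on j, k, l. This makes the differences of the shifted series a fixed multiple of the
original ones. -/
theorem theta_shift (hq : ‖q‖ < 1) (hr0 : r ≠ 0) (hr : r ^ 2 = q) {a b : Fin 3 → ℂ}
    {M N : Fin 3 → ℤ} (ha : ∏ i, a i = r) (hb : ∏ i, b i = r)
    (hM : ∑ i, M i = 0) (hN : ∑ i, N i = 0)
    {j k l : Fin 3} (hjk : j ≠ k) (hkl : k ≠ l) (hlj : l ≠ j) :
    q ^ N k * b k * theta q (q ^ N j * b j / (q ^ N k * b k)) *
        ∏ i, theta q (q ^ M i * a i * (q ^ N l * b l)) =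
      shiftFactor r a b M N * (b k * theta q (b j / b k) * ∏ i, theta q (a i * b l)) := by
  have hq0 : q ≠ 0 := by rw [← hr]; positivity
  obtain ⟨ρ, hρ⟩ : ∃ ρ, r = Complex.exp ρ := ⟨_, (Complex.exp_log hr0).symm⟩
  obtain ⟨α, hα, hαs⟩ := exists_exp_eq_of_prod_eq (ha.trans hρ)
  obtain ⟨β, hβ, hβs⟩ := exists_exp_eq_of_prod_eq (hb.trans hρ)
  have ha0 : ∀ i, a i ≠ 0 := fun i => by rw [hα]; exact Complex.exp_ne_zero _
  have hb0 : ∀ i, b i ≠ 0 := fun i => by rw [hβ]; exact Complex.exp_ne_zero _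
  have e1 : q ^ N j * b j / (q ^ N k * b k) = q ^ (N j - N k) * (b j / b k) := by
    rw [zpow_sub₀ hq0]; ring
  have e2 : ∀ i, q ^ M i * a i * (q ^ N l * b l) = q ^ (M i + N l) * (a i * b l) := fun i => by
    rw [zpow_add₀ hq0]; ring
  simp only [e1, e2]
  rw [theta_zpow_mul hq hr0 hr _ (div_ne_zero (hb0 j) (hb0 k))]
  simp only [fun i => theta_zpow_mul hq hr0 hr (M i + N l) (mul_ne_zero (ha0 i) (hb0 l))]
  rw [prod_mul_distrib]
  suffices h : q ^ N k * b k * ((-1) ^ (N j - N k) * (b j / b k) ^ (-(N j - N k)) *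
      r ^ ((N j - N k) - (N j - N k) ^ 2)) * (∏ i, ((-1) ^ (M i + N l) *
        (a i * b l) ^ (-(M i + N l)) * r ^ ((M i + N l) - (M i + N l) ^ 2))) =
      shiftFactor r a b M N * b k by
    linear_combination (theta q (b j / b k) * ∏ i, theta q (a i * b l)) * h
  rw [sum_fin_three_of_ne _ hjk hkl hlj] at hN hβs
  rw [Fin.sum_univ_three] at hM hαs
  rw [shiftFactor, prod_mul_distrib (f := fun i => a i ^ (-M i)), prod_fin_three_of_ne (fun i => b i ^ (-2 * N i)) hjk hkl hlj,
    sum_add_distrib, sum_fin_three_of_ne (fun i => 2 * N i ^ 2) hjk hkl hlj]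
  simp only [Fin.prod_univ_three, Fin.sum_univ_three, ← hr, hρ, hα, hβ, ← Complex.exp_pi_mul_I]
  have hN' : N l = -N j - N k := by linear_combination hN
  have hM' : M 2 = -M 0 - M 1 := by linear_combination hM
  have hα' : α 2 = ρ - α 0 - α 1 := by linear_combination hαs
  have hβ' : β l = ρ - β j - β k := by linear_combination hβs
  rw [hN', hM', hα', hβ']
  simp only [← Complex.exp_int_mul, ← Complex.exp_nat_mul, ← Complex.exp_sub, ← Complex.exp_add]
  rw [Complex.exp_eq_exp_iff_exists_int]
  -- Half the exponent of -1 on the left, which is N_j - N_k + 3 N_l with N_l = -N_j - N_k.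
  refine ⟨-2 * N k - N j, ?_⟩
  push_cast
  ring

/-- The residue at `z = p := q ^ (N j + s) * r ^ (-m) * b j` of the integrand divided by `z`. -/
def residueAt (q r : ℂ) (a b : Fin 3 → ℂ) (M N : Fin 3 → ℤ) (m : ℤ) (j : Fin 3) (s : ℕ) (p : ℂ) :
    ℂ :=
  (∏ i, qPoch (q * r ^ m / (a i * p)) q * qPoch (q * r ^ (-m) * p / b i) q) /
    ((∏ i, qPoch (q ^ M i * r ^ m * a i * p) q) *
      ((∏ i ∈ univ.erase j, qPoch (q ^ N i * r ^ (-m) * b i / p) q) *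
        (qFac (q ^ (-s : ℤ)) q s * qPoch q q))) * ((-1) ^ m * p ^ (-3 * m))

/-- The coefficients in the decomposition of the residues. -/
def residueCoeff (q r : ℂ) (a b : Fin 3 → ℂ) (N : Fin 3 → ℤ) (j : Fin 3) : ℂ :=
  (∏ i, theta q (a i * b j)) / (b j ^ 2 * ∏ i ∈ univ.erase j, theta q (b i / b j)) *
    (r ^ (∑ i, N i ^ 2) * (∏ i, b i ^ N i) / qPoch q q ^ 2)

theorem prod_erase_fin_three {M : Type*} [CommMonoid M] (f : Fin 3 → M) {j k l : Fin 3}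
    (hjk : j ≠ k) (hkl : k ≠ l) (hlj : l ≠ j) : ∏ i ∈ univ.erase j, f i = f k * f l := by
  have h : (univ : Finset (Fin 3)).erase j = {k, l} := by
    decide +revert
  rw [h, prod_insert (by simp [hkl]), prod_singleton]

theorem qFac_zpow_neg (hr0 : r ≠ 0) (hr : r ^ 2 = q) (s : ℕ) :
    qFac (q ^ (-s : ℤ)) q s = (-1) ^ (s : ℤ) * r ^ (-(s ^ 2 + s) : ℤ) * qFac q q s := by
  have hq0 : q ≠ 0 := by rw [← hr]; positivity
  induction s with
  | zero => simp [qFac_zero]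
  | succ s ih =>
    rw [qFac_succ', qFac_succ, show q * q ^ (-(s + 1 : ℕ) : ℤ) = q ^ (-s : ℤ) by
      rw [← zpow_one_add₀ hq0]; congr 1; push_cast; ring, ih,
      show (-((s + 1 : ℕ) ^ 2 + (s + 1 : ℕ)) : ℤ) = -(s ^ 2 + s) + -(2 * ((s + 1 : ℕ) : ℤ)) by
        push_cast; ring, zpow_add₀ hr0, zpow_neg r (2 * _), zpow_mul, zpow_neg]
    have hs : q ^ (s + 1) ≠ 0 := by positivity
    simp only [zpow_natCast]
    norm_cast
    rw [hr]
    push_cast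
    field_simp
    ring

theorem qPoch_self_ne_zero (hq : ‖q‖ < 1) : qPoch q q ≠ 0 := qPoch_ne_zero hq fun n hn => by
  have : ‖q * q ^ n‖ < 1 := by
    rw [norm_mul, norm_pow]
    exact mul_lt_one_of_nonneg_of_lt_one_left (norm_nonneg _) hq
      (pow_le_one₀ (norm_nonneg _) hq.le)
  rw [hn, norm_one] at this
  exact lt_irrefl _ this

/-- With p = r^m y = r^(-m) w, the factors on top see only y and those below only w. Theta
quasi-periodicity moves (q/(a_i y); q)_∞ into the denominator as (a_i y; q)_∞, and (q^(N_i) b_i/w;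
q)_∞ for i ≠ j into the numerator. The remaining monomials combine to y w times a constant free of m
and s. -/
theorem residueAt_eq (hq : ‖q‖ < 1) (hr0 : r ≠ 0) (hr : r ^ 2 = q) {a b : Fin 3 → ℂ}
    {M N : Fin 3 → ℤ} (ha : ∏ i, a i = r) (hb : ∏ i, b i = r) (hN : ∑ i, N i = 0)
    (hgen : IsGeneric q a b) (m : ℤ) (j : Fin 3) (s : ℕ) :
    residueAt q r a b M N m j s (q ^ (N j + s) * r ^ (-m) * b j) =
      residueCoeff q r a b N j * saalFun q a b (b j * q ^ (s - m + N j)) *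
        saalFun q (fun i => q ^ M i * a i) (fun i => q ^ N i * b i) (q ^ N j * b j * q ^ s) := by
  have hq0 : q ≠ 0 := by rw [← hr]; positivity
  obtain ⟨k, l, hjk, hkl, hlj⟩ : ∃ k l : Fin 3, j ≠ k ∧ k ≠ l ∧ l ≠ j := by
    clear hr0 hr hN; decide +revert
  obtain ⟨ρ, hρ⟩ : ∃ ρ, r = Complex.exp ρ := ⟨_, (Complex.exp_log hr0).symm⟩
  obtain ⟨α, hα, hαs⟩ := exists_exp_eq_of_prod_eq (ha.trans hρ)
  obtain ⟨β, hβ, hβs⟩ := exists_exp_eq_of_prod_eq (hb.trans hρ)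
  have ha0 : ∀ i, a i ≠ 0 := fun i => by rw [hα]; exact Complex.exp_ne_zero _
  have hb0 : ∀ i, b i ≠ 0 := fun i => by rw [hβ]; exact Complex.exp_ne_zero _
  have hrm : r ^ m ≠ 0 := zpow_ne_zero _ hr0
  have hrm2 : q ^ m = r ^ m * r ^ m := by rw [← hr, pow_two, mul_zpow]
  set p := q ^ (N j + s) * r ^ (-m) * b j with hp
  set y := b j * q ^ (s - m + N j) with hy
  set w := q ^ N j * b j * q ^ s with hw
  have hy0 : y ≠ 0 := mul_ne_zero (hb0 j) (zpow_ne_zero _ hq0)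
  have hw0 : w ≠ 0 := mul_ne_zero (mul_ne_zero (zpow_ne_zero _ hq0) (hb0 j)) (pow_ne_zero _ hq0)
  have hpy : p = r ^ m * y := by
    rw [hp, hy, show (s - m + N j : ℤ) = (N j + s) - m by ring, zpow_sub₀ hq0, hrm2, zpow_neg]
    field_simp
  have hpw : p = r ^ (-m) * w := by
    rw [hp, hw, zpow_add₀ hq0, zpow_natCast]; ring
  have hp0 : p ≠ 0 := by rw [hpy]; positivity
  have f1 : ∀ i, q * r ^ m / (a i * p) = q / (a i * y) := fun i => by
    rw [hpy]; field_simp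
  have f2 : ∀ i, q * r ^ (-m) * p / b i = q * y / b i := fun i => by
    rw [hpy, zpow_neg]; field_simp
  have f3 : ∀ i, q ^ M i * r ^ m * a i * p = q ^ M i * a i * w := fun i => by
    rw [hpw, zpow_neg]; field_simp
  have f4 : ∀ i, q ^ N i * r ^ (-m) * b i / p = q ^ N i * b i / w := fun i => by
    rw [hpw, zpow_neg]; field_simp
  have g1 : ∀ i, qPoch (a i * y) q ≠ 0 := fun i => by
    rw [hy, show a i * (b j * q ^ (s - m + N j)) = q ^ (s - m + N j) * (a i * b j) by ring]
    exact qPoch_zpow_mul_ne_zero hq hq0 (hgen.mul_ne i j) _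
  have g3 : ∀ i, qPoch (q ^ M i * a i * w) q ≠ 0 := fun i => by
    rw [hw, show q ^ M i * a i * (q ^ N j * b j * q ^ s) = q ^ (M i + N j + s) * (a i * b j) by
      rw [zpow_add₀ hq0, zpow_add₀ hq0, zpow_natCast]; ring]
    exact qPoch_zpow_mul_ne_zero hq hq0 (hgen.mul_ne i j) _
  have g4 : ∀ i, i ≠ j → qPoch (q * w / (q ^ N i * b i)) q ≠ 0 := fun i hij => by
    rw [hw, show q * (q ^ N j * b j * q ^ s) / (q ^ N i * b i) =
      q ^ (1 + N j + s - N i) * (b j / b i) by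
      rw [zpow_sub₀ hq0, zpow_add₀ hq0, zpow_add₀ hq0, zpow_natCast]; field_simp]
    refine qPoch_zpow_mul_ne_zero hq hq0 (fun n hn => hgen.right_ne j i n hij.symm ?_) _
    rw [← hn]; field_simp [hb0 i]
  have t1 : ∀ i, qPoch (q / (a i * y)) q = (-1) ^ (s - m + N j) * (a i * b j) ^ (-(s - m + N j)) *
      r ^ ((s - m + N j) - (s - m + N j) ^ 2) * theta q (a i * b j) / qPoch (a i * y) q := by
    intro i
    rw [← theta_zpow_mul hq hr0 hr _ (mul_ne_zero (ha0 i) (hb0 j)), eq_div_iff (g1 i), hy,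
      show a i * (b j * q ^ (s - m + N j)) = q ^ (s - m + N j) * (a i * b j) by ring, theta, mul_comm]
  have t4 : ∀ i, i ≠ j → qPoch (q ^ N i * b i / w) q =
      (-1) ^ (N i - N j - s) * (b i / b j) ^ (-(N i - N j - s)) *
      r ^ ((N i - N j - s) - (N i - N j - s) ^ 2) * theta q (b i / b j) /
        qPoch (q * w / (q ^ N i * b i)) q := by
    intro i hij
    rw [← theta_zpow_mul hq hr0 hr _ (div_ne_zero (hb0 i) (hb0 j)), eq_div_iff (g4 i hij),
      show q ^ (N i - N j - s) * (b i / b j) = q ^ N i * b i / w by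
        rw [hw, zpow_sub₀ hq0, zpow_sub₀ hq0, zpow_natCast]; field_simp, theta, div_div_eq_mul_div]
  have gq : qPoch q q ≠ 0 := qPoch_self_ne_zero hq
  have t5 : qPoch q q = qFac q q s * qPoch (q * w / (q ^ N j * b j)) q := by
    rw [qPoch_eq_qFac_mul hq q s, hw]
    congr 2
    field_simp [hb0 j]
  have g5 : qFac q q s ≠ 0 := left_ne_zero_of_mul (t5 ▸ gq)
  have g6 := right_ne_zero_of_mul (t5 ▸ gq)
  -- All dependence on m and s outside the two `saalFun` factors is collected in this monomial
  -- identity, where it cancels.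
  have mono : (∏ i, ((-1) ^ (s - m + N j) * (a i * b j) ^ (-(s - m + N j)) *
      r ^ ((s - m + N j) - (s - m + N j) ^ 2))) * ((-1) ^ m * p ^ (-3 * m)) * b j ^ 2 =
      r ^ (∑ i, N i ^ 2) * (∏ i, b i ^ N i) * y * w *
        (((-1) ^ (N k - N j - s) * (b k / b j) ^ (-(N k - N j - s)) *
          r ^ ((N k - N j - s) - (N k - N j - s) ^ 2)) *
        ((-1) ^ (N l - N j - s) * (b l / b j) ^ (-(N l - N j - s)) *
          r ^ ((N l - N j - s) - (N l - N j - s) ^ 2)) *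
        ((-1) ^ (s : ℤ) * r ^ (-(s ^ 2 + s) : ℤ))) := by
    rw [sum_fin_three_of_ne _ hjk hkl hlj] at hN hβs
    rw [Fin.sum_univ_three] at hαs
    rw [prod_fin_three_of_ne (fun i => b i ^ N i) hjk hkl hlj, sum_fin_three_of_ne _ hjk hkl hlj]
    simp only [hp, hy, hw, Fin.prod_univ_three, ← hr, hρ, hα, hβ, ← Complex.exp_pi_mul_I]
    have hN' : N l = -N j - N k := by linear_combination hN
    have hα' : α 2 = ρ - α 0 - α 1 := by linear_combination hαs
    have hβ' : β l = ρ - β j - β k := by linear_combination hβs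
    rw [hN', hα', hβ']
    simp only [← Complex.exp_int_mul, ← Complex.exp_nat_mul, ← Complex.exp_sub, ← Complex.exp_add]
    rw [Complex.exp_eq_exp_iff_exists_int]
    -- Half the difference of the exponents of -1: 3(s - m + N_j) + m on the left and -3 N_j - s on
    -- the right.
    refine ⟨3 * N j + 2 * s - m, ?_⟩
    push_cast
    ring
  have hkj := hjk.symm
  rw [residueAt, residueCoeff, saalFun, saalFun]
  simp only [f1, f2, f3, f4]
  rw [prod_erase_fin_three _ hjk hkl hlj, prod_erase_fin_three _ hjk hkl hlj, t4 k hkj, t4 l hlj,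
    qFac_zpow_neg hr0 hr]
  simp only [t1]
  rw [prod_div_distrib (f := fun i => qPoch (q * y / b i) q),
    prod_div_distrib (f := fun i => qPoch (q * w / (q ^ N i * b i)) q),
    prod_fin_three_of_ne (fun i => qPoch (q * w / (q ^ N i * b i)) q) hjk hkl hlj,
    prod_mul_distrib (g := fun i => qPoch (q * y / b i) q),
    prod_div_distrib (g := fun i => qPoch (a i * y) q),
    prod_mul_distrib (g := fun i => theta q (a i * b j))]
  have h1 : ∏ i, qPoch (a i * y) q ≠ 0 := prod_ne_zero_iff.2 fun i _ => g1 i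
  have h3 : ∏ i, qPoch (q ^ M i * a i * w) q ≠ 0 := prod_ne_zero_iff.2 fun i _ => g3 i
  have g4k := g4 k hkj
  have g4l := g4 l hlj
  have hT : ∀ i, i ≠ j → theta q (b i / b j) ≠ 0 := fun i hij =>
    theta_ne_zero hq hq0 fun n hn => hgen.right_ne i j n hij (by rw [← hn]; field_simp [hb0 j])
  have hTk := hT k hkj
  have hTl := hT l hlj
  have hbj := hb0 j
  have m1 : ((-1) ^ (N k - N j - s) * (b k / b j) ^ (-(N k - N j - s)) *
          r ^ ((N k - N j - s) - (N k - N j - s) ^ 2)) ≠ 0 :=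
    mul_ne_zero (mul_ne_zero (zpow_ne_zero _ (by norm_num))
      (zpow_ne_zero _ (div_ne_zero (hb0 k) (hb0 j)))) (zpow_ne_zero _ hr0)
  have m2 : ((-1) ^ (N l - N j - s) * (b l / b j) ^ (-(N l - N j - s)) *
          r ^ ((N l - N j - s) - (N l - N j - s) ^ 2)) ≠ 0 :=
    mul_ne_zero (mul_ne_zero (zpow_ne_zero _ (by norm_num))
      (zpow_ne_zero _ (div_ne_zero (hb0 l) (hb0 j)))) (zpow_ne_zero _ hr0)
  have m3 : ((-1) ^ (s : ℤ) * r ^ (-(s ^ 2 + s) : ℤ)) ≠ 0 :=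
    mul_ne_zero (zpow_ne_zero _ (by norm_num)) (zpow_ne_zero _ hr0)
  generalize ((-1) ^ (N k - N j - s) * (b k / b j) ^ (-(N k - N j - s)) *
          r ^ ((N k - N j - s) - (N k - N j - s) ^ 2)) = μ1 at *
  generalize ((-1) ^ (N l - N j - s) * (b l / b j) ^ (-(N l - N j - s)) *
          r ^ ((N l - N j - s) - (N l - N j - s) ^ 2)) = μ2 at *
  generalize ((-1) ^ (s : ℤ) * r ^ (-(s ^ 2 + s) : ℤ)) = μ3 at *
  generalize (∏ i, ((-1) ^ (s - m + N j) * (a i * b j) ^ (-(s - m + N j)) *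
      r ^ ((s - m + N j) - (s - m + N j) ^ 2))) = μ0 at *
  generalize r ^ (∑ i, N i ^ 2) * (∏ i, b i ^ N i) = R at *
  generalize (-1) ^ m * p ^ (-3 * m) = μ at *
  generalize ∏ i, qPoch (a i * y) q = A at *
  generalize ∏ i, qPoch (q ^ M i * a i * w) q = A' at *
  generalize ∏ i, qPoch (q * y / b i) q = B at *
  generalize ∏ i, theta q (a i * b j) = T at *
  rw [t5] at gq ⊢
  generalize qFac q q s = F at *
  generalize qPoch (q * w / (q ^ N j * b j)) q = Bj at *
  generalize qPoch (q * w / (q ^ N k * b k)) q = Bk at *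
  generalize qPoch (q * w / (q ^ N l * b l)) q = Bl at *
  generalize theta q (b k / b j) = Tk at *
  generalize theta q (b l / b j) = Tl at *
  clear_value y w
  generalize b j = bj at *
  have mono' : μ0 * μ = R * y * w * (μ1 * μ2 * μ3) / bj ^ 2 := by
    rw [eq_div_iff (by positivity), mono]
  calc _ = (μ0 * μ) * (T / A * B / (A' * (μ1 * Tk / Bk * (μ2 * Tl / Bl) *
        (μ3 * F * (F * Bj))))) := by ring
    _ = _ := by
      rw [mono']
      field_simp

theorem theta_div_symm (hq : ‖q‖ < 1) {x y : ℂ} (hx : x ≠ 0) (hy : y ≠ 0) :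
    x * theta q (y / x) = -(y * theta q (x / y)) := by
  rw [← inv_div, theta_inv hq (div_ne_zero hx hy)]
  field_simp

theorem IsGeneric.theta_div_ne_zero {a b : Fin 3 → ℂ} (hq : ‖q‖ < 1) (hq0 : q ≠ 0)
    (hgen : IsGeneric q a b) (hb0 : ∀ i, b i ≠ 0) {i j : Fin 3} (hij : i ≠ j) :
    theta q (b i / b j) ≠ 0 :=
  theta_ne_zero hq hq0 fun n hn => hgen.right_ne i j n hij (by rw [← hn]; field_simp [hb0 j])

theorem two_mul_ring_choose_two (n : ℤ) : 2 * Ring.choose n 2 = n ^ 2 - n := by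
  have step : ∀ n : ℤ, Ring.choose (n + 1) 2 = n + Ring.choose n 2 := fun n => by
    rw [Ring.choose_succ_succ, Ring.choose_one_right]
  induction n using Int.induction_on with
  | zero => rw [Ring.choose_zero_succ]; rfl
  | succ n ih => rw [step]; linear_combination ih
  | pred n ih =>
    have := step (-n - 1)
    rw [sub_add_cancel] at this
    linear_combination ih - 2 * this

/-- The sum of the products of the series, which is the sum of all the residues. -/
theorem sum_residueCoeff_mul (hq : ‖q‖ < 1) (hr0 : r ≠ 0) (hr : r ^ 2 = q) {a b : Fin 3 → ℂ}
    {M N : Fin 3 → ℤ} (ha : ∏ i, a i = r) (hb : ∏ i, b i = r)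
    (hM : ∑ i, M i = 0) (hN : ∑ i, N i = 0) (hgen : IsGeneric q a b) :
    ∑ j, residueCoeff q r a b N j * saalSeries q a b j *
        saalSeries q (fun i => q ^ M i * a i) (fun i => q ^ N i * b i) j =
      (∏ j, q ^ (Ring.choose (M j) 2 + Ring.choose (N j) 2) * a j ^ M j * b j ^ N j)⁻¹ *
        ∏ j, ∏ k, qPoch (q / (a j * b k)) q / qPoch (a j * b k * q ^ (M j + N k)) q := by
  have hq0 : q ≠ 0 := by rw [← hr]; positivity
  have ha0 : ∀ i, a i ≠ 0 := fun i hi => hr0 (by rw [← ha, prod_eq_zero (mem_univ i) hi])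
  have hb0 : ∀ i, b i ≠ 0 := fun i hi => hr0 (by rw [← hb, prod_eq_zero (mem_univ i) hi])
  have hprod : ∀ {a : Fin 3 → ℂ} {M : Fin 3 → ℤ}, ∏ i, a i = r → ∑ i, M i = 0 →
      ∏ i, q ^ M i * a i = r := fun {a M} ha hM => by
    have h1 : ∏ i, q ^ M i = 1 := by
      rw [Fin.sum_univ_three] at hM
      rw [Fin.prod_univ_three, ← zpow_add₀ hq0, ← zpow_add₀ hq0, hM, zpow_zero]
    rw [prod_mul_distrib, ha, h1, one_mul]
  have hab : (∏ i, a i) * ∏ i, b i = q := by rw [ha, hb, ← pow_two, hr]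
  have hab' : (∏ i, q ^ M i * a i) * ∏ i, q ^ N i * b i = q := by
    rw [hprod ha hM, hprod hb hN, ← pow_two, hr]
  have hgen' := hgen.shift hq0 M N
  have n01 : (0 : Fin 3) ≠ 1 := by decide
  have n12 : (1 : Fin 3) ≠ 2 := by decide
  have n20 : (2 : Fin 3) ≠ 0 := by decide
  have F01 := saalSeries_sub hq hq0 hab hgen n01 n12 n20
  have F12 := saalSeries_sub hq hq0 hab hgen n12 n20 n01
  have F20 := saalSeries_sub hq hq0 hab hgen n20 n01 n12
  have G01 := saalSeries_sub hq hq0 hab' hgen' n01 n12 n20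
  have G20 := saalSeries_sub hq hq0 hab' hgen' n20 n01 n12
  have S01 := theta_shift hq hr0 hr ha hb hM hN n01 n12 n20
  have S20 := theta_shift hq hr0 hr ha hb hM hN n20 n01 n12
  have hK : ∏ i, ∏ j, qPoch (a i * b j) q ≠ 0 := prod_ne_zero_iff.2 fun i _ =>
    prod_ne_zero_iff.2 fun j _ => qPoch_ne_zero_of_ne_zpow hq hq0 (hgen.mul_ne i j)
  have hK' : ∏ i, ∏ j, qPoch (q ^ M i * a i * (q ^ N j * b j)) q ≠ 0 := prod_ne_zero_iff.2 fun i _ =>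
    prod_ne_zero_iff.2 fun j _ => qPoch_ne_zero_of_ne_zpow hq hq0 (hgen'.mul_ne i j)
  have rhs : ∏ j, ∏ k, qPoch (q / (a j * b k)) q / qPoch (a j * b k * q ^ (M j + N k)) q =
      (∏ i, theta q (a i * b 0)) * (∏ i, theta q (a i * b 1)) * (∏ i, theta q (a i * b 2)) /
      ((∏ i, ∏ j, qPoch (a i * b j) q) * ∏ i, ∏ j, qPoch (q ^ M i * a i * (q ^ N j * b j)) q) := by
    rw [← Fin.prod_univ_three (fun j => ∏ i, theta q (a i * b j)), Finset.prod_comm (f := fun j i => theta q (a i * b j)),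
      ← prod_mul_distrib, ← prod_div_distrib]
    refine prod_congr rfl fun i _ => ?_
    rw [← prod_mul_distrib, ← prod_div_distrib]
    refine prod_congr rfl fun j _ => ?_
    have h1 : qPoch (a i * b j) q ≠ 0 := qPoch_ne_zero_of_ne_zpow hq hq0 (hgen.mul_ne i j)
    rw [theta, zpow_add₀ hq0, show a i * b j * (q ^ M i * q ^ N j) =
      q ^ M i * a i * (q ^ N j * b j) by ring, mul_div_mul_left _ _ h1]
  have pre : (∏ j, q ^ (Ring.choose (M j) 2 + Ring.choose (N j) 2) * a j ^ M j * b j ^ N j)⁻¹ =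
      shiftFactor r a b M N * (r ^ (∑ i, N i ^ 2) * ∏ i, b i ^ N i) := by
    have e : ∏ j, q ^ (Ring.choose (M j) 2 + Ring.choose (N j) 2) =
        r ^ (∑ i, M i ^ 2 + ∑ i, N i ^ 2) := by
      rw [Fin.sum_univ_three] at hM hN
      rw [Fin.prod_univ_three, ← zpow_add₀ hq0, ← zpow_add₀ hq0, ← hr, ← zpow_natCast, ← zpow_mul]
      congr 1
      simp only [Fin.sum_univ_three, mul_add, Nat.cast_ofNat, two_mul_ring_choose_two]
      linear_combination -hM - hN
    simp only [prod_mul_distrib, e, shiftFactor, sum_add_distrib, ← mul_sum, neg_mul, zpow_neg,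
      prod_inv_distrib]
    have hA : ∏ i, a i ^ M i ≠ 0 := prod_ne_zero_iff.2 fun i _ => zpow_ne_zero _ (ha0 i)
    have hB : ∏ i, b i ^ N i ≠ 0 := prod_ne_zero_iff.2 fun i _ => zpow_ne_zero _ (hb0 i)
    have hB2 : ∏ i, b i ^ (2 * N i) = (∏ i, b i ^ N i) ^ 2 := by
      rw [← prod_pow]
      refine prod_congr rfl fun i _ => ?_
      rw [mul_comm, zpow_mul]
      norm_cast
    rw [hB2, show ∑ i, M i ^ 2 + 2 * ∑ i, N i ^ 2 = (∑ i, M i ^ 2 + ∑ i, N i ^ 2) + ∑ i, N i ^ 2 by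
      ring, zpow_add₀ hr0 (_ + _)]
    have e1 : r ^ (∑ i, M i ^ 2 + ∑ i, N i ^ 2) ≠ 0 := zpow_ne_zero _ hr0
    have e2 : r ^ (∑ i, N i ^ 2) ≠ 0 := zpow_ne_zero _ hr0
    generalize r ^ (∑ i, M i ^ 2 + ∑ i, N i ^ 2) = E1 at *
    generalize r ^ (∑ i, N i ^ 2) = E2 at *
    field_simp
  rw [rhs, pre, Fin.sum_univ_three]
  have c0 : b 0 * theta q (b 1 / b 0) = -(b 1 * theta q (b 0 / b 1)) := theta_div_symm hq (hb0 _) (hb0 _)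
  have c1 : b 1 * theta q (b 2 / b 1) = -(b 2 * theta q (b 1 / b 2)) := theta_div_symm hq (hb0 _) (hb0 _)
  have c2 : b 2 * theta q (b 0 / b 2) = -(b 0 * theta q (b 2 / b 0)) := theta_div_symm hq (hb0 _) (hb0 _)
  have d0 : b 0 ^ 2 * ∏ i ∈ univ.erase 0, theta q (b i / b 0) =
      -((b 1 * theta q (b 0 / b 1)) * (b 0 * theta q (b 2 / b 0))) := by
    rw [prod_erase_fin_three _ n01 n12 n20]
    linear_combination b 0 * theta q (b 2 / b 0) * c0
  have d1 : b 1 ^ 2 * ∏ i ∈ univ.erase 1, theta q (b i / b 1) =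
      -((b 2 * theta q (b 1 / b 2)) * (b 1 * theta q (b 0 / b 1))) := by
    rw [prod_erase_fin_three _ n12 n20 n01]
    linear_combination b 1 * theta q (b 0 / b 1) * c1
  have d2 : b 2 ^ 2 * ∏ i ∈ univ.erase 2, theta q (b i / b 2) =
      -((b 0 * theta q (b 2 / b 0)) * (b 2 * theta q (b 1 / b 2))) := by
    rw [prod_erase_fin_three _ n20 n01 n12]
    linear_combination b 2 * theta q (b 1 / b 2) * c2
  have hX : b 1 * theta q (b 0 / b 1) ≠ 0 :=
    mul_ne_zero (hb0 _) (hgen.theta_div_ne_zero hq hq0 hb0 n01)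
  have hY : b 2 * theta q (b 1 / b 2) ≠ 0 :=
    mul_ne_zero (hb0 _) (hgen.theta_div_ne_zero hq hq0 hb0 n12)
  have hZ : b 0 * theta q (b 2 / b 0) ≠ 0 :=
    mul_ne_zero (hb0 _) (hgen.theta_div_ne_zero hq hq0 hb0 n20)
  have hQ : qPoch q q ≠ 0 := qPoch_self_ne_zero hq
  rw [residueCoeff, residueCoeff, residueCoeff, d0, d1, d2]
  rw [mul_right_comm _ (qPoch q q)] at F01 F12 F20 G01 G20
  rw [S01] at G01
  rw [S20] at G20
  generalize saalSeries q a b 0 = f0 at *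
  generalize saalSeries q a b 1 = f1 at *
  generalize saalSeries q a b 2 = f2 at *
  generalize saalSeries q (fun i => q ^ M i * a i) (fun i => q ^ N i * b i) 0 = g0 at *
  generalize saalSeries q (fun i => q ^ M i * a i) (fun i => q ^ N i * b i) 1 = g1 at *
  generalize saalSeries q (fun i => q ^ M i * a i) (fun i => q ^ N i * b i) 2 = g2 at *
  generalize shiftFactor r a b M N = L at *
  generalize r ^ (∑ i, N i ^ 2) * (∏ i, b i ^ N i) = R at *
  generalize ∏ i, ∏ j, qPoch (a i * b j) q = K at *
  generalize ∏ i, ∏ j, qPoch (q ^ M i * a i * (q ^ N j * b j)) q = K' at *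
  generalize ∏ i, theta q (a i * b 0) = T0 at *
  generalize ∏ i, theta q (a i * b 1) = T1 at *
  generalize ∏ i, theta q (a i * b 2) = T2 at *
  generalize b 1 * theta q (b 0 / b 1) = X at *
  generalize b 2 * theta q (b 1 / b 2) = Y at *
  generalize b 0 * theta q (b 2 / b 0) = Z at *
  generalize qPoch q q = Q at *
  -- The three-term theta relation, read off from (f0 - f1) + (f1 - f2) + (f2 - f0) = 0.
  have hsum : X * T2 + Y * T0 + Z * T1 = 0 := by
    have h : (-(X * T2 * Q) / K) + (-(Y * T0 * Q) / K) + (-(Z * T1 * Q) / K) = 0 := by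
      rw [← F01, ← F12, ← F20]; ring
    field_simp at h
    refine mul_left_cancel₀ hQ ?_
    linear_combination -h
  have hT0 : T0 = -(X * T2 + Z * T1) / Y := by
    rw [eq_div_iff hY]; linear_combination hsum
  have hf1 : f1 = f0 + X * T2 * Q / K := by linear_combination -F01
  have hf2 : f2 = f0 - Z * T1 * Q / K := by linear_combination F20
  have hg1 : g1 = g0 + L * (X * T2) * Q / K' := by linear_combination -G01
  have hg2 : g2 = g0 - L * (Z * T1) * Q / K' := by linear_combination G20
  -- Up to a constant the sum is Y T0 f0 g0 + Z T1 f1 g1 + X T2 f2 g2. The coefficient of f0 g0 is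
  -- zero by `hsum`, the terms linear in f0 or g0 cancel in pairs, and the rest is a multiple of X Z
  -- T1 T2 (X T2 + Z T1) = -X Y Z T0 T1 T2.
  rw [hf1, hf2, hg1, hg2, hT0]
  clear * - hX hY hZ hQ hK hK'
  field_simp
  ring

end SQED

end

/-! ### Piecewise C¹ contours, logarithms and comparison with circles -/

noncomputable section

namespace SQED

open Filter Topology MeasureTheory Set

theorem contourIntegral_eq (f : ℂ → ℂ) {x y : ℂ} (γ : Path x y) :
    contourIntegral f γ = ∫ t in (0 : ℝ)..1, deriv γ.extend t * f (γ.extend t) := by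
  rw [contourIntegral, curveIntegral_eq_intervalIntegral_deriv]
  simp [ContinuousLinearMap.toSpanSingleton_apply]

theorem IsPiecewiseC1.contDiffAt {x y : ℂ} {γ : Path x y} (h : IsPiecewiseC1 γ) :
    ∃ s : Set ℝ, s.Countable ∧ ∀ t ∈ Ioo (0 : ℝ) 1 \ s, ContDiffAt ℝ 1 γ.extend t := by
  obtain ⟨P, hP⟩ := h
  refine ⟨P, P.countable_toSet, fun t ⟨ht, htP⟩ => ?_⟩
  have ho : Ioo (0 : ℝ) 1 ∩ (P : Set ℝ)ᶜ ∈ 𝓝 t :=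
    inter_mem (isOpen_Ioo.mem_nhds ht) (P.finite_toSet.isClosed.isOpen_compl.mem_nhds htP)
  obtain ⟨δ, hδ, hs⟩ := Metric.nhds_basis_closedBall.mem_iff.1 ho
  rw [Real.closedBall_eq_Icc] at hs
  have h1 := (hs (left_mem_Icc.2 (by linarith))).1
  have h2 := (hs (right_mem_Icc.2 (by linarith))).1
  exact (hP (t - δ) (t + δ) h1.1.le (by linarith) h2.2.le
    (Set.disjoint_left.2 fun u hu => (hs (Ioo_subset_Icc_self hu)).2)).contDiffAt
    (Icc_mem_nhds (by linarith) (by linarith))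

theorem integrableOn_deriv_of_contDiffOn {f : ℝ → ℂ} {c d : ℝ} (hcd : c < d)
    (h : ContDiffOn ℝ 1 f (Icc c d)) : IntegrableOn (deriv f) (Icc c d) := by
  rw [integrableOn_Icc_iff_integrableOn_Ioo]
  have h1 : IntegrableOn (derivWithin f (Icc c d)) (Icc c d) :=
    (h.continuousOn_derivWithin (uniqueDiffOn_Icc hcd) le_rfl).integrableOn_Icc
  refine (h1.mono_set Ioo_subset_Icc_self).congr_fun (fun t ht => ?_) measurableSet_Ioo
  exact derivWithin_of_mem_nhds (Icc_mem_nhds ht.1 ht.2)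

theorem exists_Ioc_disjoint (P : Finset ℝ) (t : ℝ) :
    ∃ δ > 0, Disjoint (Ioo (t - δ) t) (P : Set ℝ) ∧ Disjoint (Ioo t (t + δ)) (P : Set ℝ) := by
  have ho : ((P.erase t : Finset ℝ) : Set ℝ)ᶜ ∈ 𝓝 t :=
    (P.erase t).finite_toSet.isClosed.isOpen_compl.mem_nhds (by simp)
  obtain ⟨δ, hδ, hs⟩ := Metric.nhds_basis_closedBall.mem_iff.1 ho
  rw [Real.closedBall_eq_Icc] at hs
  refine ⟨δ, hδ, Set.disjoint_left.2 fun u hu hP => ?_, Set.disjoint_left.2 fun u hu hP => ?_⟩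
  · exact hs ⟨hu.1.le, by linarith [hu.2]⟩ (by simpa using ⟨hP, hu.2.ne⟩)
  · exact hs ⟨by linarith [hu.1], hu.2.le⟩ (by simpa using ⟨hP, hu.1.ne'⟩)

/-- On either side of each point there is a short interval without break points in its interior,
where the derivative agrees off the endpoints with a continuous one-sided derivative. Compactness
glues these intervals. -/
theorem IsPiecewiseC1.intervalIntegrable_deriv {x y : ℂ} {γ : Path x y} (h : IsPiecewiseC1 γ) :
    IntervalIntegrable (deriv γ.extend) volume 0 1 := by
  obtain ⟨P, hP⟩ := h
  rw [intervalIntegrable_iff_integrableOn_Icc_of_le zero_le_one]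
  refine LocallyIntegrableOn.integrableOn_isCompact (fun t ht => ?_) isCompact_Icc
  obtain ⟨δ, hδ, h1, h2⟩ := exists_Ioc_disjoint P t
  have hl : IntegrableOn (deriv γ.extend) (Icc (max 0 (t - δ)) t) := by
    rcases lt_or_ge (max 0 (t - δ)) t with hlt | hge
    · refine integrableOn_deriv_of_contDiffOn hlt (hP _ _ (le_max_left _ _) hlt ht.2 ?_)
      exact h1.mono_left (Ioo_subset_Ioo_left (le_max_right _ _))
    · exact IntegrableOn.of_measure_zero (by simp [hge])
  have hr : IntegrableOn (deriv γ.extend) (Icc t (min 1 (t + δ))) := by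
    rcases lt_or_ge t (min 1 (t + δ)) with hlt | hge
    · refine integrableOn_deriv_of_contDiffOn hlt (hP _ _ ht.1 hlt (min_le_left _ _) ?_)
      exact h2.mono_left (Ioo_subset_Ioo_right (min_le_right _ _))
    · exact IntegrableOn.of_measure_zero (by simp [hge])
  refine ⟨Icc (max 0 (t - δ)) t ∪ Icc t (min 1 (t + δ)), ?_, hl.union hr⟩
  refine mem_nhdsWithin_iff_exists_mem_nhds_inter.2
    ⟨Icc (t - δ) (t + δ), Icc_mem_nhds (by linarith) (by linarith), fun u hu => ?_⟩
  rcases le_total u t with hut | hut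
  · exact Or.inl ⟨max_le hu.2.1 hu.1.1, hut⟩
  · exact Or.inr ⟨hut, le_min hu.2.2 hu.1.2⟩

theorem intervalIntegrable_deriv_mul {x y : ℂ} {γ : Path x y} (h : IsPiecewiseC1 γ) {f : ℂ → ℂ}
    (hf : ContinuousOn (fun t => f (γ.extend t)) (Icc 0 1)) :
    IntervalIntegrable (fun t => deriv γ.extend t * f (γ.extend t)) volume 0 1 :=
  h.intervalIntegrable_deriv.mul_continuousOn (by rwa [uIcc_of_le zero_le_one])

theorem hasDerivAt_const_zero_imp {f : ℝ → ℂ} {s : Set ℝ} (hs : s.Countable)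
    (hc : ContinuousOn f (Icc 0 1)) (hd : ∀ t ∈ Ioo (0 : ℝ) 1 \ s, HasDerivAt f 0 t) {t : ℝ}
    (ht : t ∈ Icc (0 : ℝ) 1) : f t = f 0 := by
  have := integral_eq_of_hasDerivAt_off_countable_of_le f (fun _ => 0) ht.1 hs
    (hc.mono (Icc_subset_Icc_right ht.2))
    (fun u hu => hd u ⟨⟨hu.1.1, hu.1.2.trans_le ht.2⟩, hu.2⟩) (by simp)
  rw [intervalIntegral.integral_zero] at this
  exact (sub_eq_zero.1 this.symm)

/-- A piecewise `C^1` path that avoids the origin has a logarithm. -/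
theorem IsPiecewiseC1.exists_log {x y : ℂ} {γ : Path x y} (h : IsPiecewiseC1 γ)
    (h0 : ∀ t ∈ Icc (0 : ℝ) 1, γ.extend t ≠ 0) :
    ∃ (l : ℝ → ℂ) (s : Set ℝ), s.Countable ∧ ContinuousOn l (Icc 0 1) ∧
      (∀ t ∈ Icc (0 : ℝ) 1, γ.extend t = Complex.exp (l t)) ∧
      (∀ t ∈ Ioo (0 : ℝ) 1 \ s, HasDerivAt l (deriv γ.extend t * (γ.extend t)⁻¹) t) ∧
      l 1 - l 0 = contourIntegral (fun z => (z - 0)⁻¹) γ := by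
  obtain ⟨s, hs, hd⟩ := h.contDiffAt
  have hcont : ContinuousOn (fun t => (γ.extend t)⁻¹) (Icc 0 1) :=
    γ.continuous_extend.continuousOn.inv₀ h0
  have hint : IntervalIntegrable (fun t => deriv γ.extend t * (γ.extend t)⁻¹) volume 0 1 :=
    intervalIntegrable_deriv_mul h (f := fun z => z⁻¹) hcont
  let l : ℝ → ℂ := fun t => Complex.log (γ.extend 0) +
    ∫ u in (0 : ℝ)..t, deriv γ.extend u * (γ.extend u)⁻¹
  have hl : ContinuousOn l (Icc 0 1) := by
    refine continuousOn_const.add ?_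
    have := intervalIntegral.continuousOn_primitive_interval' hint left_mem_uIcc
    rwa [uIcc_of_le zero_le_one] at this
  have hl' : ∀ t ∈ Ioo (0 : ℝ) 1 \ s, HasDerivAt l (deriv γ.extend t * (γ.extend t)⁻¹) t := by
    intro t ht
    refine HasDerivAt.const_add _ ?_
    have htI : t ∈ Icc (0 : ℝ) 1 := Ioo_subset_Icc_self ht.1
    refine intervalIntegral.integral_hasDerivAt_right
      (hint.mono_set (by
        rw [uIcc_of_le zero_le_one, uIcc_of_le htI.1]; exact Icc_subset_Icc_right htI.2)) ?_ ?_
    · refine StronglyMeasurable.stronglyMeasurableAtFilter ?_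
      exact ((measurable_deriv _).mul γ.continuous_extend.measurable.inv).stronglyMeasurable
    · refine ContinuousAt.mul ?_ (γ.continuous_extend.continuousAt.inv₀ (h0 t htI))
      have h1 := ((hd t ht).fderiv_right (m := 0) le_rfl).continuousAt
      exact (h1.clm_apply continuousAt_const : ContinuousAt (fun u => fderiv ℝ γ.extend u 1) t)
  refine ⟨l, s, hs, hl, fun t ht => ?_, hl', ?_⟩
  -- The function γ e^(-l) equals 1 at 0 and has zero derivative off a countable set.
  · have key := hasDerivAt_const_zero_imp (f := fun t => γ.extend t * Complex.exp (-l t)) hs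
      (γ.continuous_extend.continuousOn.mul hl.neg.cexp) (fun u hu => ?_) ht
    · have e0 : γ.extend 0 * Complex.exp (-l 0) = 1 := by
        simp only [l, intervalIntegral.integral_same, add_zero, Complex.exp_neg]
        rw [Complex.exp_log (h0 0 (by simp)), mul_inv_cancel₀ (h0 0 (by simp))]
      simp only [e0] at key
      rw [Complex.exp_neg] at key
      rwa [mul_inv_eq_one₀ (Complex.exp_ne_zero _)] at key
    · have h1 := ((hd u hu).differentiableAt (by simp)).hasDerivAt
      have h2 := h1.mul (hl' u hu).neg.cexp
      refine h2.congr_deriv ?_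
      have := h0 u (Ioo_subset_Icc_self hu.1)
      field_simp
      ring
  · simp [l, contourIntegral_eq]

/-- A closed contour in an annulus that winds once around the origin can be replaced by a circle. -/
theorem contourIntegral_eq_circleIntegral {ε R ρ : ℝ} (hε : 0 < ε) (hρ : ε < ρ) (hR : ρ < R)
    {g : ℂ → ℂ} (hg : DifferentiableOn ℂ g {z | ε < ‖z‖ ∧ ‖z‖ < R}) {x : ℂ} {γ : Path x x}
    (h : IsPiecewiseC1 γ) (hU : ∀ t ∈ Icc (0 : ℝ) 1, ε < ‖γ.extend t‖ ∧ ‖γ.extend t‖ < R)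
    (hw : windingNumber γ 0 = 1) : contourIntegral g γ = ∮ z in C(0, ρ), g z := by
  let S : Set ℂ := {w | Real.log ε < w.re ∧ w.re < Real.log R}
  have hSc : Convex ℝ S := by
    have := (convex_Ioo (Real.log ε) (Real.log R)).is_linear_preimage Complex.reLm.isLinear
    exact this
  have hSo : IsOpen S :=
    (isOpen_Ioo (a := Real.log ε) (b := Real.log R)).preimage Complex.continuous_re
  have hρ0 : 0 < ρ := hε.trans hρ
  have hR0 : 0 < R := hρ0.trans hR
  have hSmem : ∀ w : ℂ, w ∈ S ↔ ε < ‖Complex.exp w‖ ∧ ‖Complex.exp w‖ < R := fun w => by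
    rw [Complex.norm_exp, ← Real.log_lt_iff_lt_exp hε, ← Real.lt_log_iff_exp_lt hR0]
    rfl
  have hdiff : DifferentiableOn ℂ (fun w => g (Complex.exp w) * Complex.exp w) S := by
    refine DifferentiableOn.mul ?_ Complex.differentiable_exp.differentiableOn
    exact hg.comp Complex.differentiable_exp.differentiableOn fun w hw => (hSmem w).1 hw
  -- Pulled back by exp, the annulus becomes a convex strip, so the form g(z) dz has a primitive
  -- there even though it need not have one on the annulus.
  obtain ⟨G, hG'⟩ := hSc.exists_forall_hasDerivWithinAt hdiff
  have hG : ∀ w ∈ S, HasDerivAt G (g (Complex.exp w) * Complex.exp w) w := fun w hw =>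
    (hG' w hw).hasDerivAt (hSo.mem_nhds hw)
  have hS2 : ∀ w, w ∈ S → w + 2 * Real.pi * Complex.I ∈ S := fun w hw => by
    rw [hSmem] at hw ⊢
    rwa [Complex.exp_periodic w]
  -- The period of the primitive under w ↦ w + 2πi is constant on the strip. The contour and the
  -- circle both lift to paths that gain exactly 2πi, so their integrals both equal this period.
  have hconst : ∀ v ∈ S, ∀ w ∈ S, G (v + 2 * Real.pi * Complex.I) - G v =
      G (w + 2 * Real.pi * Complex.I) - G w := by
    have hd : ∀ w ∈ S, HasDerivAt (fun w => G (w + 2 * Real.pi * Complex.I) - G w) 0 w := by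
      intro w hw
      have h1 := (hG _ (hS2 w hw)).comp_add_const w (2 * Real.pi * Complex.I)
      refine (h1.sub (hG w hw)).congr_deriv ?_
      rw [Complex.exp_periodic w, sub_self]
    intro v hv w hw
    exact hSo.is_const_of_deriv_eq_zero hSc.isPreconnected
      (fun w hw => (hd w hw).differentiableAt.differentiableWithinAt)
      (fun w hw => (hd w hw).deriv) hv hw
  obtain ⟨l, s, hs, hl, hle, hl', hl1⟩ := h.exists_log
    (fun t ht h0 => by have := (hU t ht).1; rw [h0, norm_zero] at this; linarith)
  have hlS : ∀ t ∈ Icc (0 : ℝ) 1, l t ∈ S := fun t ht => by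
    rw [hSmem, ← hle t ht]; exact hU t ht
  have hl2 : l 1 = l 0 + 2 * Real.pi * Complex.I := by
    rw [windingNumber, ← hl1, inv_mul_eq_one₀ Complex.two_pi_I_ne_zero] at hw
    linear_combination -hw
  have hlhs : contourIntegral g γ = G (l 1) - G (l 0) := by
    rw [contourIntegral_eq]
    refine integral_eq_of_hasDerivAt_off_countable_of_le (fun t => G (l t)) _ zero_le_one hs ?_ ?_ ?_
    · exact ContinuousOn.comp (t := S) (fun w hw => (hG w hw).continuousAt.continuousWithinAt) hl hlS
    · intro t ht
      have htI := Ioo_subset_Icc_self ht.1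
      refine ((hG _ (hlS t htI)).scomp t (hl' t ht)).congr_deriv ?_
      have h0 : γ.extend t ≠ 0 := by rw [hle t htI]; exact Complex.exp_ne_zero _
      rw [← hle t htI, smul_eq_mul]
      field_simp
    · exact intervalIntegrable_deriv_mul h
        (hg.continuousOn.comp γ.continuous_extend.continuousOn hU)
  have hcs : ∀ θ : ℝ, (Real.log ρ : ℂ) + θ * Complex.I ∈ S := fun θ => by
    simp only [S, mem_ofPred_eq, Complex.add_re, Complex.ofReal_re, Complex.mul_re, Complex.I_re,
      mul_zero, Complex.ofReal_im, zero_mul, sub_self, add_zero]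
    exact ⟨Real.log_lt_log hε hρ, Real.log_lt_log hρ0 hR⟩
  have hce : ∀ θ : ℝ, Complex.exp (Real.log ρ + θ * Complex.I) = circleMap 0 ρ θ := fun θ => by
    rw [Complex.exp_add, ← Complex.ofReal_exp, Real.exp_log hρ0, circleMap, zero_add]
  have hrhs : (∮ z in C(0, ρ), g z) =
      G (Real.log ρ + (2 * Real.pi : ℝ) * Complex.I) - G (Real.log ρ + (0 : ℝ) * Complex.I) := by
    rw [circleIntegral]
    refine intervalIntegral.integral_eq_sub_of_hasDerivAt
      (f := fun θ : ℝ => G (Real.log ρ + θ * Complex.I)) (fun θ _ => ?_) ?_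
    · have h1 : HasDerivAt (fun θ : ℝ => (Real.log ρ : ℂ) + θ * Complex.I) Complex.I θ := by
        simpa using ((Complex.ofRealCLM.hasDerivAt (x := θ)).mul_const Complex.I).const_add
          (Real.log ρ : ℂ)
      refine ((hG _ (hcs θ)).scomp θ h1).congr_deriv ?_
      rw [hce, deriv_circleMap]
      simp only [smul_eq_mul]
      ring
    · have : CircleIntegrable g 0 ρ := ContinuousOn.circleIntegrable hρ0.le (hg.continuousOn.mono
        fun z hz => by
          rw [mem_sphere_zero_iff_norm] at hz
          exact ⟨by rw [hz]; exact hρ, by rw [hz]; exact hR⟩)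
      exact this.out
  rw [hlhs, hl2, hrhs, hconst _ (hlS 0 (by simp)) _ (hcs 0)]
  push_cast
  simp

end SQED

end

/-! ### The residue theorem in an annulus -/

noncomputable section

namespace SQED

open Filter Topology MeasureTheory Set

/-- A function with finitely many simple poles is the sum of its principal parts and a holomorphic
function. -/
theorem exists_differentiableOn_sub_principalParts {U : Set ℂ} (hU : IsOpen U) (c : ℂ → ℂ)
    (P : Finset ℂ) (hP : (P : Set ℂ) ⊆ U) (F : ℂ → ℂ) (hF : DifferentiableOn ℂ F (U \ P))
    (hc : ∀ p ∈ P, Tendsto (fun z => (z - p) * F z) (𝓝[≠] p) (𝓝 (c p))) :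
    ∃ g : ℂ → ℂ, DifferentiableOn ℂ g U ∧
      ∀ z ∈ U \ P, F z = g z + ∑ p ∈ P, c p * (z - p)⁻¹ := by
  induction P using Finset.induction_on generalizing F with
  | empty => exact ⟨F, by simpa using hF, by simp⟩
  | insert p P hp ih =>
    have hpU : p ∈ U := hP (by simp)
    have hPU : (P : Set ℂ) ⊆ U := fun z hz => hP (by simp [Finset.mem_coe.1 hz])
    have hUP : IsOpen (U \ P) := hU.sdiff P.finite_toSet.isClosed
    let F₀ : ℂ → ℂ := fun z => F z - c p * (z - p)⁻¹
    let F₁ : ℂ → ℂ := Function.update F₀ p (limUnder (𝓝[≠] p) F₀)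
    have hpar : DifferentiableOn ℂ (fun z => c p * (z - p)⁻¹) {p}ᶜ := by
      intro z hz
      refine DifferentiableAt.differentiableWithinAt ?_
      have : z - p ≠ 0 := sub_ne_zero.2 hz
      fun_prop (disch := assumption)
    have hd : DifferentiableOn ℂ F₀ ((U \ P) \ {p}) := by
      refine DifferentiableOn.sub (hF.mono fun z hz => ⟨hz.1.1, ?_⟩) (hpar.mono fun z hz => hz.2)
      rw [Finset.mem_coe, Finset.mem_insert]
      exact not_or.2 ⟨hz.2, hz.1.2⟩
    -- Subtracting the principal part leaves a function that is o(1/(z - p)), so the singularity is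
    -- removable; the value of `F₀` at p plays no role.
    have hlim : Tendsto (fun z => (z - p) * (F₀ z - F₀ p)) (𝓝[≠] p) (𝓝 0) := by
      have h1 := hc p (by simp)
      have h2 : Tendsto (fun z : ℂ => (z - p) * F₀ p) (𝓝[≠] p) (𝓝 ((p - p) * F₀ p)) :=
        (Continuous.tendsto (by fun_prop) p).mono_left nhdsWithin_le_nhds
      have h3 := (h1.sub_const (c p)).sub h2
      rw [sub_self, sub_self, zero_mul, sub_zero] at h3
      refine h3.congr' ?_
      filter_upwards [self_mem_nhdsWithin] with z hz
      have : z - p ≠ 0 := sub_ne_zero.2 hz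
      simp only [F₀]
      field_simp
    have hd₁ : DifferentiableOn ℂ F₁ (U \ P) := by
      refine Complex.differentiableOn_update_limUnder_of_isLittleO
        (hUP.mem_nhds ⟨hpU, by simpa using hp⟩) hd ?_
      rw [Asymptotics.isLittleO_iff_tendsto']
      · refine hlim.congr fun z => ?_
        rw [div_inv_eq_mul, mul_comm]
      · filter_upwards [self_mem_nhdsWithin] with z hz h0
        exact absurd (inv_eq_zero.1 h0) (sub_ne_zero.2 hz)
    have hF₁ : ∀ z, z ≠ p → F₁ z = F z - c p * (z - p)⁻¹ := fun z hz => by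
      simp only [F₁, Function.update_of_ne hz, F₀]
    obtain ⟨g, hg, hgF⟩ := ih hPU F₁ hd₁ fun p' hp' => by
      have hne : p' ≠ p := fun h => hp (h ▸ hp')
      have h1 := hc p' (by simp [hp'])
      have h2 : Tendsto (fun z : ℂ => (z - p') * (c p * (z - p)⁻¹)) (𝓝[≠] p')
          (𝓝 ((p' - p') * (c p * (p' - p)⁻¹))) := by
        refine Tendsto.mono_left ?_ nhdsWithin_le_nhds
        have : ContinuousAt (fun z : ℂ => (z - p') * (c p * (z - p)⁻¹)) p' := by
          have : p' - p ≠ 0 := sub_ne_zero.2 hne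
          fun_prop (disch := assumption)
        exact this
      have h3 := h1.sub h2
      rw [sub_self, zero_mul, sub_zero] at h3
      refine h3.congr' ?_
      filter_upwards [nhdsWithin_le_nhds (isOpen_ne.mem_nhds hne)] with z hz
      rw [hF₁ z hz]
      ring
    refine ⟨g, hg, fun z hz => ?_⟩
    have hz' := hz.2
    rw [Finset.mem_coe, Finset.mem_insert, not_or] at hz'
    have := hgF z ⟨hz.1, hz'.2⟩
    rw [hF₁ z hz'.1] at this
    rw [Finset.sum_insert hp]
    linear_combination this

/-- A path has zero derivative almost everywhere on each of its level sets. -/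
theorem IsPiecewiseC1.ae_deriv_eq_zero {x y : ℂ} {γ : Path x y} (h : IsPiecewiseC1 γ) (p : ℂ) :
    ∀ᵐ t : ℝ, t ∈ Ioo (0 : ℝ) 1 → γ.extend t = p → deriv γ.extend t = 0 := by
  obtain ⟨s, hs, hd⟩ := h.contDiffAt
  let T : Set ℝ := {t | t ∈ Ioo (0 : ℝ) 1 \ s ∧ γ.extend t = p ∧ deriv γ.extend t ≠ 0}
  have hT : T.Countable := by
    -- Where the derivative is nonzero the path leaves the level p at once, so each point of `T` is
    -- isolated from the right in `T`; such points are only countably many.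
    refine (countable_setOfPred_isolated_right_within (s := T)).mono fun t ht => ?_
    refine mem_ofPred_eq ▸ ⟨ht, ?_⟩
    have h1 := ((hd t ht.1).differentiableAt (by simp)).hasDerivAt.eventually_ne (c := p) ht.2.2
    rw [← empty_mem_iff_bot]
    have h2 : T ∩ Ioi t ⊆ {t}ᶜ := fun u hu => hu.2.ne'
    filter_upwards [nhdsWithin_mono t h2 h1, self_mem_nhdsWithin] with u hu hu'
    exact hu hu'.1.2.1
  filter_upwards [(hs.union hT).ae_notMem volume] with t ht htI htp
  by_contra hne
  exact ht (Or.inr ⟨⟨htI, fun h => ht (Or.inl h)⟩, htp, hne⟩)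

/-- The residue theorem in an annulus. -/
theorem contourIntegral_eq_circleIntegral_add {ε R ρ : ℝ} (hε : 0 < ε) (hρ : ε < ρ) (hR : ρ < R)
    {F c : ℂ → ℂ} {P : Finset ℂ} (hP : (P : Set ℂ) ⊆ {z | ε < ‖z‖ ∧ ‖z‖ < R})
    (hF : DifferentiableOn ℂ F ({z | ε < ‖z‖ ∧ ‖z‖ < R} \ P))
    (hc : ∀ p ∈ P, Tendsto (fun z => (z - p) * F z) (𝓝[≠] p) (𝓝 (c p)))
    (hPρ : ∀ p ∈ P, ‖p‖ ≠ ρ) {x : ℂ} {γ : Path x x}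
    (h : IsPiecewiseC1 γ) (hU : ∀ t ∈ Icc (0 : ℝ) 1, ε < ‖γ.extend t‖ ∧ ‖γ.extend t‖ < R)
    (hw : windingNumber γ 0 = 1) (hγ : ∀ p ∈ P, c p ≠ 0 → p ∉ range γ) :
    contourIntegral F γ = (∮ z in C(0, ρ), F z) +
      2 * Real.pi * Complex.I *
        ∑ p ∈ P, c p * (windingNumber γ p - if ‖p‖ < ρ then 1 else 0) := by
  have hρ0 : 0 < ρ := hε.trans hρ
  have hUo : IsOpen {z : ℂ | ε < ‖z‖ ∧ ‖z‖ < R} :=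
    (isOpen_lt continuous_const continuous_norm).inter (isOpen_lt continuous_norm continuous_const)
  obtain ⟨g, hg, hgF⟩ := exists_differentiableOn_sub_principalParts hUo c P hP F hF hc
  have hpγ : ∀ p ∈ P, c p ≠ 0 → ∀ t, γ.extend t ≠ p := fun p hp hcp t ht =>
    hγ p hp hcp (by rw [← Path.extend_range]; exact ⟨t, ht⟩)
  have hlhs : contourIntegral F γ = contourIntegral g γ +
      ∑ p ∈ P, c p * (2 * Real.pi * Complex.I * windingNumber γ p) := by
    have hterm : ∀ p ∈ P, IntervalIntegrable
        (fun t => c p * (deriv γ.extend t * (γ.extend t - p)⁻¹)) volume 0 1 := by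
      intro p hp
      rcases eq_or_ne (c p) 0 with h0 | h0
      · simp [h0]
      · refine (intervalIntegrable_deriv_mul h (f := fun z => (z - p)⁻¹) ?_).const_mul _
        exact (γ.continuous_extend.sub continuous_const).continuousOn.inv₀
          fun t _ => sub_ne_zero.2 (hpγ p hp h0 t)
    have hwn : ∀ p, 2 * Real.pi * Complex.I * windingNumber γ p =
        ∫ t in (0 : ℝ)..1, deriv γ.extend t * (γ.extend t - p)⁻¹ := fun p => by
      rw [windingNumber, contourIntegral_eq, mul_inv_cancel_left₀ Complex.two_pi_I_ne_zero]
    simp only [hwn, ← intervalIntegral.integral_const_mul]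
    rw [← intervalIntegral.integral_finsetSum hterm, contourIntegral_eq, contourIntegral_eq,
      ← intervalIntegral.integral_add (intervalIntegrable_deriv_mul h
        (hg.continuousOn.comp γ.continuous_extend.continuousOn hU))
        (by
          have := IntervalIntegrable.sum P hterm
          refine this.congr fun t _ => ?_
          simp)]
    -- The contour may run through points with c p = 0, where F can differ from its holomorphic
    -- extension. There the derivative of the path is zero for almost every parameter, so the
    -- integrands still agree almost everywhere.
    have hae : ∀ᵐ t : ℝ, ∀ p ∈ P, t ∈ Ioo (0 : ℝ) 1 → γ.extend t = p → deriv γ.extend t = 0 := by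
      exact (ae_ball_iff P.countable_toSet).2 fun p _ => h.ae_deriv_eq_zero p
    refine intervalIntegral.integral_congr_ae ?_
    rw [uIoc_of_le zero_le_one]
    filter_upwards [hae, (countable_singleton (1 : ℝ)).ae_notMem volume] with t ht ht1 htI
    have htI' : t ∈ Ioo (0 : ℝ) 1 := ⟨htI.1, lt_of_le_of_ne htI.2 ht1⟩
    by_cases htP : γ.extend t ∈ P
    · rw [ht _ htP htI' rfl]
      simp
    · rw [hgF _ ⟨hU t (Ioo_subset_Icc_self htI'), htP⟩, mul_add, Finset.mul_sum]
      congr 1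
      exact Finset.sum_congr rfl fun p _ => by ring
  have hball : ∀ p : ℂ, ‖p‖ ≠ ρ → ∀ z ∈ Metric.sphere (0 : ℂ) ρ, z ≠ p := fun p hp z hz hzp => by
    rw [mem_sphere_zero_iff_norm, hzp] at hz
    exact hp hz
  have hcirc : ∀ p : ℂ, ‖p‖ ≠ ρ → (∮ z in C(0, ρ), (z - p)⁻¹) =
      2 * Real.pi * Complex.I * if ‖p‖ < ρ then 1 else 0 := by
    intro p hp
    split_ifs with hlt
    · rw [circleIntegral.integral_sub_inv_of_mem_ball (by simpa using hlt), mul_one]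
    · rw [mul_zero]
      have hsub : ∀ z ∈ Metric.closedBall (0 : ℂ) ρ, z - p ≠ 0 := fun z hz h0 => by
        rw [mem_closedBall_zero_iff, sub_eq_zero.1 h0] at hz
        exact hlt (lt_of_le_of_ne hz hp)
      refine Complex.circleIntegral_eq_zero_of_differentiable_on_off_countable hρ0.le
        countable_empty ((continuousOn_id.sub continuousOn_const).inv₀ hsub) fun z hz => ?_
      have := hsub z (Metric.ball_subset_closedBall hz.1)
      fun_prop (disch := assumption)
  have hsph : ∀ z ∈ Metric.sphere (0 : ℂ) ρ, ε < ‖z‖ ∧ ‖z‖ < R := fun z hz => by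
    rw [mem_sphere_zero_iff_norm] at hz
    rw [hz]
    exact ⟨hρ, hR⟩
  have hrhs : (∮ z in C(0, ρ), F z) = (∮ z in C(0, ρ), g z) +
      ∑ p ∈ P, c p * (2 * Real.pi * Complex.I * if ‖p‖ < ρ then 1 else 0) := by
    have hterm : ∀ p ∈ P, CircleIntegrable (fun z => c p * (z - p)⁻¹) 0 ρ := fun p hp =>
      ContinuousOn.circleIntegrable hρ0.le (continuousOn_const.mul
        ((continuousOn_id.sub continuousOn_const).inv₀
          fun z hz => sub_ne_zero.2 (hball p (hPρ p hp) z hz)))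
    have e1 : (∮ z in C(0, ρ), F z) = ∮ z in C(0, ρ), (g z + ∑ p ∈ P, c p * (z - p)⁻¹) :=
      circleIntegral.integral_congr hρ0.le fun z hz =>
        hgF z ⟨hsph z hz, fun hzP => hball z (hPρ z hzP) z hz rfl⟩
    rw [e1, circleIntegral.integral_add
      (ContinuousOn.circleIntegrable hρ0.le (hg.continuousOn.mono hsph))
      (CircleIntegrable.fun_sum P hterm), circleIntegral.integral_fun_sum hterm]
    congr 1
    refine Finset.sum_congr rfl fun p hp => ?_
    rw [circleIntegral.integral_const_mul, hcirc p (hPρ p hp)]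
  rw [hlhs, hrhs, contourIntegral_eq_circleIntegral hε hρ hR hg h hU hw, add_assoc,
    Finset.mul_sum, ← Finset.sum_add_distrib]
  congr 1
  exact Finset.sum_congr rfl fun p _ => by ring

end SQED

end

/-! ### The poles of the integrand and their residues -/

noncomputable section

namespace SQED

open Filter Topology MeasureTheory Finset

variable {q r : ℂ} {a b : Fin 3 → ℂ} {M N : Fin 3 → ℤ} {m : ℤ}

/-- The zeros of the factors `(q^{N_j-m/2} b_j/z; q)_∞`. -/
def poleZero (q r : ℂ) (b : Fin 3 → ℂ) (N : Fin 3 → ℤ) (m : ℤ) (x : Fin 3 × ℕ) : ℂ :=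
  q ^ (N x.1 + x.2) * r ^ (-m) * b x.1

/-- The zeros of the factors `(q^{M_j+m/2} a_j z; q)_∞`. -/
def poleInfinity (q r : ℂ) (a : Fin 3 → ℂ) (M : Fin 3 → ℤ) (m : ℤ) (x : Fin 3 × ℕ) : ℂ :=
  (q ^ (M x.1 + x.2) * r ^ m * a x.1)⁻¹

theorem integrand_eq (z : ℂ) : integrand q r a b M N m z =
    (∏ i, qPoch (q * r ^ m / (a i * z)) q * qPoch (q * r ^ (-m) * z / b i) q) /
      ((∏ i, qPoch (q ^ M i * r ^ m * a i * z) q) *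
        (∏ i, qPoch (q ^ N i * r ^ (-m) * b i / z) q)) * ((-1) ^ m * z ^ (-3 * m)) := by
  rw [integrand, prod_div_distrib, prod_mul_distrib (g := fun i => qPoch (_ / z) q)]

theorem poleZero_eq_mul_pow (hq0 : q ≠ 0) (j : Fin 3) (s : ℕ) :
    poleZero q r b N m (j, s) = q ^ N j * r ^ (-m) * b j * q ^ s := by
  rw [poleZero, zpow_add₀ hq0, zpow_natCast]
  ring

theorem poleInfinity_eq_inv (hq0 : q ≠ 0) (j : Fin 3) (s : ℕ) :
    poleInfinity q r a M m (j, s) = (q ^ M j * r ^ m * a j * q ^ s)⁻¹ := by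
  rw [poleInfinity, zpow_add₀ hq0, zpow_natCast]
  ring

theorem qPoch_ne_zero_of_notMem_poleZero (hq : ‖q‖ < 1) (hq0 : q ≠ 0) {z : ℂ} (hz : z ≠ 0)
    {i : Fin 3} (h : ∀ s, z ≠ poleZero q r b N m (i, s)) :
    qPoch (q ^ N i * r ^ (-m) * b i / z) q ≠ 0 := by
  refine qPoch_ne_zero hq fun s hs => h s ?_
  rw [poleZero_eq_mul_pow hq0]
  field_simp at hs
  exact hs.symm

theorem qPoch_ne_zero_of_notMem_poleInfinity (hq : ‖q‖ < 1) (hq0 : q ≠ 0) {z : ℂ}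
    {i : Fin 3} (h : ∀ s, z ≠ poleInfinity q r a M m (i, s)) :
    qPoch (q ^ M i * r ^ m * a i * z) q ≠ 0 := by
  refine qPoch_ne_zero hq fun s hs => h s ?_
  rw [poleInfinity_eq_inv hq0]
  refine eq_inv_of_mul_eq_one_left ?_
  rw [← hs]
  ring

theorem differentiableAt_qPoch_div (hq : ‖q‖ < 1) (c : ℂ) {z : ℂ} (hz : z ≠ 0) :
    DifferentiableAt ℂ (fun z => qPoch (c / z) q) z :=
  ((differentiable_qPoch hq) (c / z)).comp z (by fun_prop (disch := assumption))

theorem differentiableAt_qPoch_mul (hq : ‖q‖ < 1) (c z : ℂ) :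
    DifferentiableAt ℂ (fun z => qPoch (c * z) q) z :=
  ((differentiable_qPoch hq) (c * z)).comp z (by fun_prop)

theorem differentiableAt_numerator (hq : ‖q‖ < 1) {z : ℂ} (hz : z ≠ 0) :
    DifferentiableAt ℂ (fun z => ∏ i, qPoch (q * r ^ m / (a i * z)) q *
      qPoch (q * r ^ (-m) * z / b i) q) z := by
  refine DifferentiableAt.fun_finsetProd fun i _ => ?_
  simp only [← div_div, mul_div_right_comm (q * r ^ (-m))]
  exact (differentiableAt_qPoch_div hq _ hz).mul (differentiableAt_qPoch_mul hq _ z)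

theorem differentiableAt_sign_mul_zpow {z : ℂ} (hz : z ≠ 0) :
    DifferentiableAt ℂ (fun z : ℂ => (-1 : ℂ) ^ m * z ^ (-3 * m)) z :=
  (differentiableAt_zpow.2 (Or.inl hz)).const_mul _

theorem differentiableAt_integrand (hq : ‖q‖ < 1) (hq0 : q ≠ 0) {z : ℂ} (hz : z ≠ 0)
    (h1 : ∀ x, z ≠ poleZero q r b N m x) (h2 : ∀ x, z ≠ poleInfinity q r a M m x) :
    DifferentiableAt ℂ (integrand q r a b M N m) z := by
  rw [funext (integrand_eq (q := q))]
  refine DifferentiableAt.mul ?_ (differentiableAt_sign_mul_zpow hz)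
  refine (differentiableAt_numerator hq hz).div (DifferentiableAt.mul ?_ ?_) (mul_ne_zero ?_ ?_)
  · exact DifferentiableAt.fun_finsetProd fun i _ => differentiableAt_qPoch_mul hq _ z
  · exact DifferentiableAt.fun_finsetProd fun i _ => differentiableAt_qPoch_div hq _ hz
  · exact prod_ne_zero_iff.2 fun i _ =>
      qPoch_ne_zero_of_notMem_poleInfinity hq hq0 fun s => h2 (i, s)
  · exact prod_ne_zero_iff.2 fun i _ =>
      qPoch_ne_zero_of_notMem_poleZero hq hq0 hz fun s => h1 (i, s)

theorem qPoch_eq_mul_mul (hq : ‖q‖ < 1) (x : ℂ) (s : ℕ) :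
    qPoch x q = (1 - x * q ^ s) * (qFac x q s * qPoch (x * q ^ (s + 1)) q) := by
  rw [qPoch_eq_qFac_mul hq x (s + 1), qFac_succ]
  ring

theorem pow_injective_of_norm_lt_one (hq : ‖q‖ < 1) (hq0 : q ≠ 0) {i j : ℤ} (h : q ^ i = q ^ j) :
    i = j :=
  zpow_right_injective₀ (norm_pos_iff.2 hq0) hq.ne (by simpa [norm_zpow] using congrArg norm h)

theorem qFac_ne_zero {x : ℂ} {s : ℕ} (h : ∀ i < s, x * q ^ i ≠ 1) : qFac x q s ≠ 0 :=
  prod_ne_zero_iff.2 fun i hi h0 => h i (mem_range.1 hi) (by linear_combination -h0)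

theorem qFac_zpow_neg_ne_zero (hq : ‖q‖ < 1) (hq0 : q ≠ 0) (s : ℕ) :
    qFac (q ^ (-s : ℤ)) q s ≠ 0 := by
  refine qFac_ne_zero fun i hi h => ?_
  rw [← zpow_natCast, ← zpow_add₀ hq0, ← zpow_zero q] at h
  have := pow_injective_of_norm_lt_one hq hq0 h
  omega

/-- Since no quotient b_j / b_k with j ≠ k is a power of q, and powers of q are distinct, the listed
zeros do not repeat. Together with `poleZero_ne_poleInfinity` this makes every pole at most simple.
-/
theorem poleZero_injective (hq : ‖q‖ < 1) (hq0 : q ≠ 0) (hr0 : r ≠ 0) (hb0 : ∀ i, b i ≠ 0)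
    (hgen : IsGeneric q a b) : Function.Injective (poleZero q r b N m) := by
  rintro ⟨j, s⟩ ⟨k, t⟩ h
  simp only [poleZero] at h
  have hrm : r ^ (-m) ≠ 0 := zpow_ne_zero _ hr0
  have h1 : q ^ (N j + s) * b j = q ^ (N k + t) * b k :=
    mul_right_cancel₀ hrm (by linear_combination h)
  have hjk : j = k := by
    by_contra hne
    refine hgen.right_ne j k ((N k + t) - (N j + s)) hne ?_
    have := zpow_ne_zero (N j + s) hq0
    rw [zpow_sub₀ hq0 (N k + t)]
    field_simp
    linear_combination h1
  subst hjk
  have := pow_injective_of_norm_lt_one hq hq0 (mul_right_cancel₀ (hb0 j) h1)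
  simp only [Prod.mk.injEq, true_and]
  omega

theorem poleInfinity_injective (hq : ‖q‖ < 1) (hq0 : q ≠ 0) (hr0 : r ≠ 0) (ha0 : ∀ i, a i ≠ 0)
    (hgen : IsGeneric q a b) : Function.Injective (poleInfinity q r a M m) := by
  rintro ⟨j, s⟩ ⟨k, t⟩ h
  simp only [poleInfinity, inv_inj] at h
  have hrm : r ^ m ≠ 0 := zpow_ne_zero _ hr0
  have h1 : q ^ (M j + s) * a j = q ^ (M k + t) * a k :=
    mul_right_cancel₀ hrm (by linear_combination h)
  have hjk : j = k := by
    by_contra hne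
    refine hgen.left_ne j k ((M k + t) - (M j + s)) hne ?_
    have := zpow_ne_zero (M j + s) hq0
    rw [zpow_sub₀ hq0 (M k + t)]
    field_simp
    linear_combination h1
  subst hjk
  have := pow_injective_of_norm_lt_one hq hq0 (mul_right_cancel₀ (ha0 j) h1)
  simp only [Prod.mk.injEq, true_and]
  omega

theorem poleZero_ne_poleInfinity (hq0 : q ≠ 0) (hr0 : r ≠ 0) (ha0 : ∀ i, a i ≠ 0)
    (hgen : IsGeneric q a b) (x y : Fin 3 × ℕ) :
    poleZero q r b N m x ≠ poleInfinity q r a M m y := by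
  intro h
  refine hgen.mul_ne y.1 x.1 (-(N x.1 + x.2) - (M y.1 + y.2)) ?_
  rw [poleInfinity, ← mul_eq_one_iff_eq_inv₀ (mul_ne_zero (mul_ne_zero (zpow_ne_zero _ hq0)
    (zpow_ne_zero _ hr0)) (ha0 _)), poleZero, zpow_neg] at h
  rw [zpow_sub₀ hq0 (-_), zpow_neg]
  have h1 := zpow_ne_zero m hr0
  have h2 := zpow_ne_zero (N x.1 + x.2) hq0
  have h3 := zpow_ne_zero (M y.1 + y.2) hq0
  generalize q ^ (N x.1 + x.2) = A at *
  generalize q ^ (M y.1 + y.2) = B at *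
  generalize r ^ m = C at *
  field_simp at h ⊢
  linear_combination h

theorem poleZero_ne_zero (hq0 : q ≠ 0) (hr0 : r ≠ 0) (hb0 : ∀ i, b i ≠ 0) (x : Fin 3 × ℕ) :
    poleZero q r b N m x ≠ 0 :=
  mul_ne_zero (mul_ne_zero (zpow_ne_zero _ hq0) (zpow_ne_zero _ hr0)) (hb0 _)

theorem poleInfinity_ne_zero (hq0 : q ≠ 0) (hr0 : r ≠ 0) (ha0 : ∀ i, a i ≠ 0) (x : Fin 3 × ℕ) :
    poleInfinity q r a M m x ≠ 0 :=
  inv_ne_zero (mul_ne_zero (mul_ne_zero (zpow_ne_zero _ hq0) (zpow_ne_zero _ hr0)) (ha0 _))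

theorem continuous_qFac (q : ℂ) (s : ℕ) : Continuous fun x => qFac x q s := by
  unfold qFac
  fun_prop

theorem tendsto_integrand_poleZero (hq : ‖q‖ < 1) (hq0 : q ≠ 0) (hr0 : r ≠ 0)
    (ha0 : ∀ i, a i ≠ 0) (hb0 : ∀ i, b i ≠ 0) (hgen : IsGeneric q a b) (j : Fin 3) (s : ℕ) :
    Tendsto (fun z => (z - poleZero q r b N m (j, s)) * (integrand q r a b M N m z / z))
      (𝓝[≠] poleZero q r b N m (j, s))
      (𝓝 (residueAt q r a b M N m j s (poleZero q r b N m (j, s)))) := by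
  set p := poleZero q r b N m (j, s) with hp
  have hp0 : p ≠ 0 := poleZero_ne_zero hq0 hr0 hb0 _
  have hpe : p = q ^ N j * r ^ (-m) * b j * q ^ s := poleZero_eq_mul_pow hq0 j s
  -- The denominator without its one vanishing factor 1 - p/z = (z - p)/z. Its z cancels the one in
  -- dz/z.
  let D : ℂ → ℂ := fun z => (∏ i, qPoch (q ^ M i * r ^ m * a i * z) q) *
    ((∏ i ∈ univ.erase j, qPoch (q ^ N i * r ^ (-m) * b i / z) q) *
      (qFac (q ^ N j * r ^ (-m) * b j / z) q s *
        qPoch (q ^ N j * r ^ (-m) * b j / z * q ^ (s + 1)) q))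
  have e1 : q ^ N j * r ^ (-m) * b j / p = q ^ (-s : ℤ) := by
    rw [div_eq_iff hp0, hpe, zpow_neg q (s : ℤ), zpow_natCast]
    field_simp
  have e2 : q ^ N j * r ^ (-m) * b j / p * q ^ (s + 1) = q := by
    rw [e1, pow_succ, zpow_neg, zpow_natCast]
    field_simp
  have hDp : D p ≠ 0 := by
    refine mul_ne_zero (prod_ne_zero_iff.2 fun i _ => ?_) (mul_ne_zero
      (prod_ne_zero_iff.2 fun i hi => ?_) (mul_ne_zero ?_ ?_))
    · exact qPoch_ne_zero_of_notMem_poleInfinity hq hq0 fun t =>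
        poleZero_ne_poleInfinity hq0 hr0 ha0 hgen _ _
    · refine qPoch_ne_zero_of_notMem_poleZero hq hq0 hp0 fun t h => ?_
      have := poleZero_injective hq hq0 hr0 hb0 hgen h
      exact (mem_erase.1 hi).1 (congrArg Prod.fst this).symm
    · rw [e1]; exact qFac_zpow_neg_ne_zero hq hq0 s
    · rw [e2]; exact qPoch_self_ne_zero hq
  have hDc : ContinuousAt D p := by
    have hdiv : ∀ c : ℂ, ContinuousAt (fun z => c / z) p := fun c => by
      fun_prop (disch := assumption)
    refine ContinuousAt.mul ?_ (ContinuousAt.mul ?_ (ContinuousAt.mul ?_ ?_))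
    · exact (DifferentiableAt.fun_finsetProd fun i _ =>
        differentiableAt_qPoch_mul hq _ p).continuousAt
    · exact (DifferentiableAt.fun_finsetProd fun i _ =>
        differentiableAt_qPoch_div hq _ hp0).continuousAt
    · exact (continuous_qFac q s).continuousAt.comp (hdiv _)
    · exact (continuous_qPoch hq).continuousAt.comp ((hdiv _).mul continuousAt_const)
  have hlim := (((differentiableAt_numerator (r := r) (m := m) (a := a) (b := b) hq
    hp0).continuousAt.div hDc hDp).mul
    (differentiableAt_sign_mul_zpow (m := m) hp0).continuousAt).tendsto.mono_left
      (nhdsWithin_le_nhds (s := {p}ᶜ))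
  have hval : residueAt q r a b M N m j s p = (∏ i, qPoch (q * r ^ m / (a i * p)) q *
      qPoch (q * r ^ (-m) * p / b i) q) / D p * ((-1) ^ m * p ^ (-3 * m)) := by
    simp only [D, residueAt]
    rw [e2, e1]
  rw [hval]
  refine hlim.congr' ?_
  filter_upwards [self_mem_nhdsWithin, nhdsWithin_le_nhds (isOpen_ne.mem_nhds hp0)] with z hzp hz0
  have hzp' : z - p ≠ 0 := sub_ne_zero.2 hzp
  have hz0' : z ≠ 0 := hz0
  rw [integrand_eq]
  simp only [Pi.mul_apply, Pi.div_apply, D]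
  rw [← mul_prod_erase univ (fun i => qPoch (q ^ N i * r ^ (-m) * b i / z) q) (mem_univ j),
    qPoch_eq_mul_mul hq (q ^ N j * r ^ (-m) * b j / z) s,
    show 1 - q ^ N j * r ^ (-m) * b j / z * q ^ s = (z - p) / z by rw [hpe]; field_simp]
  generalize ∏ i, qPoch (q * r ^ m / (a i * z)) q * qPoch (q * r ^ (-m) * z / b i) q = A
  generalize ∏ i, qPoch (q ^ M i * r ^ m * a i * z) q = B
  generalize ∏ i ∈ univ.erase j, qPoch (q ^ N i * r ^ (-m) * b i / z) q = C
  generalize qFac (q ^ N j * r ^ (-m) * b j / z) q s = E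
  generalize qPoch (q ^ N j * r ^ (-m) * b j / z * q ^ (s + 1)) q = G
  generalize (-1) ^ m * z ^ (-3 * m) = H
  generalize z - p = y at *
  have hy : y * y⁻¹ = 1 := mul_inv_cancel₀ hzp'
  have hz : z * z⁻¹ = 1 := mul_inv_cancel₀ hz0'
  simp only [div_eq_mul_inv, mul_inv, inv_inv]
  linear_combination (-A * B⁻¹ * C⁻¹ * E⁻¹ * G⁻¹ * H) * hy -
    A * B⁻¹ * C⁻¹ * E⁻¹ * G⁻¹ * H * y * y⁻¹ * hz

/-- Only existence of the limit matters, since true poles of this kind have winding number 0. For s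
< -m - M_j the numerator contains (q^(1+M_j+s+m); q)_∞, whose exponent is at most 0; it vanishes and
the singularity is removable. -/
theorem tendsto_integrand_poleInfinity (hq : ‖q‖ < 1) (hq0 : q ≠ 0) (hr0 : r ≠ 0) (hr : r ^ 2 = q)
    (ha0 : ∀ i, a i ≠ 0) (hgen : IsGeneric q a b) (j : Fin 3) (s : ℕ) :
    ∃ c, Tendsto (fun z => (z - poleInfinity q r a M m (j, s)) * (integrand q r a b M N m z / z))
      (𝓝[≠] poleInfinity q r a M m (j, s)) (𝓝 c) ∧ (s < -m - M j → c = 0) := by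
  set p := poleInfinity q r a M m (j, s) with hp
  have hp0 : p ≠ 0 := poleInfinity_ne_zero hq0 hr0 ha0 _
  have hpe : p = (q ^ M j * r ^ m * a j * q ^ s)⁻¹ := poleInfinity_eq_inv hq0 j s
  have hα : q ^ M j * r ^ m * a j ≠ 0 :=
    mul_ne_zero (mul_ne_zero (zpow_ne_zero _ hq0) (zpow_ne_zero _ hr0)) (ha0 _)
  let D : ℂ → ℂ := fun z => (∏ i, qPoch (q ^ N i * r ^ (-m) * b i / z) q) *
    ((∏ i ∈ univ.erase j, qPoch (q ^ M i * r ^ m * a i * z) q) *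
      (qFac (q ^ M j * r ^ m * a j * z) q s * qPoch (q ^ M j * r ^ m * a j * z * q ^ (s + 1)) q)) *
        (-p⁻¹) * z
  have e1 : q ^ M j * r ^ m * a j * p = q ^ (-s : ℤ) := by
    rw [hpe, zpow_neg q (s : ℤ), zpow_natCast, mul_inv, mul_inv_cancel_left₀ hα]
  have e2 : q ^ M j * r ^ m * a j * p * q ^ (s + 1) = q := by
    rw [e1, pow_succ, zpow_neg, zpow_natCast]
    field_simp
  have hDp : D p ≠ 0 := by
    refine mul_ne_zero (mul_ne_zero (mul_ne_zero (prod_ne_zero_iff.2 fun i _ => ?_) (mul_ne_zero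
      (prod_ne_zero_iff.2 fun i hi => ?_) (mul_ne_zero ?_ ?_)))
      (neg_ne_zero.2 (inv_ne_zero hp0))) hp0
    · exact qPoch_ne_zero_of_notMem_poleZero hq hq0 hp0 fun t h =>
        poleZero_ne_poleInfinity hq0 hr0 ha0 hgen _ _ h.symm
    · refine qPoch_ne_zero_of_notMem_poleInfinity hq hq0 fun t h => ?_
      have := poleInfinity_injective hq hq0 hr0 ha0 hgen h
      exact (mem_erase.1 hi).1 (congrArg Prod.fst this).symm
    · rw [e1]; exact qFac_zpow_neg_ne_zero hq hq0 s
    · rw [e2]; exact qPoch_self_ne_zero hq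
  have hDc : ContinuousAt D p := by
    have hmul : ∀ c : ℂ, ContinuousAt (fun z => c * z) p := fun c => by fun_prop
    refine ((ContinuousAt.mul ?_ (ContinuousAt.mul ?_ (ContinuousAt.mul ?_ ?_))).mul
      continuousAt_const).mul continuousAt_id
    · exact (DifferentiableAt.fun_finsetProd fun i _ =>
        differentiableAt_qPoch_div hq _ hp0).continuousAt
    · exact (DifferentiableAt.fun_finsetProd fun i _ =>
        differentiableAt_qPoch_mul hq _ p).continuousAt
    · exact (continuous_qFac q s).continuousAt.comp (hmul _)
    · exact (continuous_qPoch hq).continuousAt.comp ((hmul _).mul continuousAt_const)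
  have hlim := (((differentiableAt_numerator (r := r) (m := m) (a := a) (b := b) hq
    hp0).continuousAt.div hDc hDp).mul
    (differentiableAt_sign_mul_zpow (m := m) hp0).continuousAt).tendsto.mono_left
      (nhdsWithin_le_nhds (s := {p}ᶜ))
  refine ⟨_, hlim.congr' ?_, fun hs => ?_⟩
  · filter_upwards [self_mem_nhdsWithin, nhdsWithin_le_nhds (isOpen_ne.mem_nhds hp0)] with z hzp hz0
    have hzp' : z - p ≠ 0 := sub_ne_zero.2 hzp
    rw [integrand_eq]
    simp only [Pi.mul_apply, Pi.div_apply, D]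
    rw [← mul_prod_erase univ (fun i => qPoch (q ^ M i * r ^ m * a i * z) q) (mem_univ j),
      qPoch_eq_mul_mul hq (q ^ M j * r ^ m * a j * z) s,
      show 1 - q ^ M j * r ^ m * a j * z * q ^ s = (z - p) * (-p⁻¹) by
        rw [sub_mul, mul_neg, mul_neg, mul_inv_cancel₀ hp0, hpe, inv_inv]; ring]
    generalize ∏ i, qPoch (q * r ^ m / (a i * z)) q * qPoch (q * r ^ (-m) * z / b i) q = A
    generalize ∏ i ∈ univ.erase j, qPoch (q ^ M i * r ^ m * a i * z) q = B
    generalize ∏ i, qPoch (q ^ N i * r ^ (-m) * b i / z) q = C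
    generalize qFac (q ^ M j * r ^ m * a j * z) q s = E
    generalize qPoch (q ^ M j * r ^ m * a j * z * q ^ (s + 1)) q = G
    generalize (-1) ^ m * z ^ (-3 * m) = H
    generalize z - p = y at *
    generalize -p⁻¹ = p' at *
    have hy : y * y⁻¹ = 1 := mul_inv_cancel₀ hzp'
    simp only [div_eq_mul_inv, mul_inv]
    linear_combination (-A * B⁻¹ * C⁻¹ * E⁻¹ * G⁻¹ * H * p'⁻¹ * z⁻¹) * hy
  · have h0 : ∏ i, qPoch (q * r ^ m / (a i * p)) q * qPoch (q * r ^ (-m) * p / b i) q = 0 := by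
      refine prod_eq_zero (mem_univ j) ?_
      obtain ⟨t, ht⟩ : ∃ t : ℕ, (t : ℤ) = -(1 + M j + s + m) :=
        ⟨(-(1 + M j + s + m)).toNat, Int.toNat_of_nonneg (by omega)⟩
      rw [qPoch_eq_zero hq (n := t), zero_mul]
      have hrm2 : q ^ m = r ^ m * r ^ m := by rw [← hr, pow_two, mul_zpow]
      have h1 : q * r ^ m / (a j * p) = q ^ (1 + M j + s + m) := by
        rw [zpow_add₀ hq0, zpow_add₀ hq0, zpow_add₀ hq0, zpow_one, zpow_natCast, hrm2, hpe]
        field_simp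
        exact div_self (ha0 j)
      rw [h1, ← zpow_natCast, ht, ← zpow_add₀ hq0, add_neg_cancel, zpow_zero]
    simp only [Pi.mul_apply, Pi.div_apply]
    rw [h0, zero_div, zero_mul]

end SQED

end

/-! ### Decay at the origin and the integral as a sum of residues -/

noncomputable section

namespace SQED

open Filter Topology MeasureTheory Finset

variable {q r : ℂ} {a b : Fin 3 → ℂ} {M N : Fin 3 → ℤ} {m : ℤ}

/-- The factor (q^(1+n); q)_∞ vanishes for n < 0. This makes bilateral sums one-sided, and it
accounts for the cancelled poles among the zeros of the denominator. -/
theorem saalFun_mul_zpow_eq_zero (hq : ‖q‖ < 1) (hq0 : q ≠ 0) (hb0 : ∀ i, b i ≠ 0) (j : Fin 3)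
    {n : ℤ} (hn : n < 0) : saalFun q a b (b j * q ^ n) = 0 := by
  have h : qPoch (q * (b j * q ^ n) / b j) q = 0 := by
    obtain ⟨t, ht⟩ : ∃ t : ℕ, (t : ℤ) = -(1 + n) :=
      ⟨(-(1 + n)).toNat, Int.toNat_of_nonneg (by omega)⟩
    refine qPoch_eq_zero hq (n := t) ?_
    rw [show q * (b j * q ^ n) / b j = q ^ (1 + n) by
        rw [zpow_add₀ hq0, zpow_one, mul_left_comm, mul_div_cancel_left₀ _ (hb0 j)],
      ← zpow_natCast, ht, ← zpow_add₀ hq0, add_neg_cancel, zpow_zero]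
  rw [saalFun, prod_eq_zero (mem_univ j) (by rw [h, zero_div]), mul_zero]

theorem residueAt_eq_zero (hq : ‖q‖ < 1) (hr0 : r ≠ 0) (hr : r ^ 2 = q)
    (ha : ∏ i, a i = r) (hb : ∏ i, b i = r) (hN : ∑ i, N i = 0) (hgen : IsGeneric q a b)
    {j : Fin 3} {s : ℕ} (h : s < m - N j) :
    residueAt q r a b M N m j s (poleZero q r b N m (j, s)) = 0 := by
  have hq0 : q ≠ 0 := by rw [← hr]; positivity
  have hb0 : ∀ i, b i ≠ 0 := fun i hi => hr0 (by rw [← hb, prod_eq_zero (mem_univ i) hi])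
  rw [poleZero, residueAt_eq hq hr0 hr ha hb hN hgen, saalFun_mul_zpow_eq_zero hq hq0 hb0 j
    (by omega), mul_zero, zero_mul]

/-- The quotient of the values of the integrand at `q z` and at `z`. -/
def integrandRatio (q r : ℂ) (a b : Fin 3 → ℂ) (M N : Fin 3 → ℤ) (m : ℤ) (z : ℂ) : ℂ :=
  (∏ i, (q * z - q * r ^ m / a i) * (1 - q ^ M i * r ^ m * a i * z) /
    ((q * z - q ^ N i * r ^ (-m) * b i) * (1 - q * r ^ (-m) / b i * z))) * q ^ (-3 * m)

theorem integrand_mul_left (hq : ‖q‖ < 1) (hq0 : q ≠ 0) {z : ℂ} (hz : z ≠ 0)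
    (h1 : ∀ i, 1 - q ^ M i * r ^ m * a i * z ≠ 0) (h2 : ∀ i, 1 - q * r ^ (-m) / b i * z ≠ 0) :
    integrand q r a b M N m (q * z) = integrandRatio q r a b M N m z * integrand q r a b M N m z := by
  have e : ∀ i, qPoch (q * r ^ m / (a i * (q * z))) q * qPoch (q * r ^ (-m) * (q * z) / b i) q /
      (qPoch (q ^ M i * r ^ m * a i * (q * z)) q * qPoch (q ^ N i * r ^ (-m) * b i / (q * z)) q) =
      (q * z - q * r ^ m / a i) * (1 - q ^ M i * r ^ m * a i * z) /
        ((q * z - q ^ N i * r ^ (-m) * b i) * (1 - q * r ^ (-m) / b i * z)) *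
      (qPoch (q * r ^ m / (a i * z)) q * qPoch (q * r ^ (-m) * z / b i) q /
        (qPoch (q ^ M i * r ^ m * a i * z) q * qPoch (q ^ N i * r ^ (-m) * b i / z) q)) :=
      fun i => by
    have h3 : qPoch (q * r ^ m / (a i * (q * z))) q =
        (q * z - q * r ^ m / a i) / (q * z) * qPoch (q * r ^ m / (a i * z)) q := by
      rw [qPoch_eq_one_sub_mul hq]
      congr 2 <;> field_simp
    have h4 : qPoch (q ^ N i * r ^ (-m) * b i / (q * z)) q =
        (q * z - q ^ N i * r ^ (-m) * b i) / (q * z) * qPoch (q ^ N i * r ^ (-m) * b i / z) q := by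
      rw [qPoch_eq_one_sub_mul hq]
      congr 2 <;> field_simp
    have h5 : qPoch (q * r ^ (-m) * z / b i) q =
        (1 - q * r ^ (-m) / b i * z) * qPoch (q * r ^ (-m) * (q * z) / b i) q := by
      rw [qPoch_eq_one_sub_mul hq]
      congr 2 <;> ring
    have h6 : qPoch (q ^ M i * r ^ m * a i * z) q =
        (1 - q ^ M i * r ^ m * a i * z) * qPoch (q ^ M i * r ^ m * a i * (q * z)) q := by
      rw [qPoch_eq_one_sub_mul hq]
      congr 2
      ring
    have h1 := h1 i
    have h2 := h2 i
    rw [h3, h4, h5, h6]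
    generalize 1 - q ^ M i * r ^ m * a i * z = A at *
    generalize 1 - q * r ^ (-m) / b i * z = B at *
    generalize q * z - q ^ N i * r ^ (-m) * b i = C
    generalize q * z - q * r ^ m / a i = D
    field_simp
  rw [integrand, integrand, integrandRatio]
  simp only [e]
  rw [prod_mul_distrib, mul_zpow]
  ring

/-- At z = 0 the three factors multiply to q³ q^(3m) / (r · r), using that the N_i add up to 0. The
power q^(-3m) from z^(-3m) removes the dependence on m. -/
theorem tendsto_integrandRatio (hq0 : q ≠ 0) (hr0 : r ≠ 0) (hr : r ^ 2 = q)
    (ha : ∏ i, a i = r) (hb : ∏ i, b i = r) (hN : ∑ i, N i = 0) :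
    Tendsto (integrandRatio q r a b M N m) (𝓝 0) (𝓝 (q ^ 2)) := by
  have ha0 : ∀ i, a i ≠ 0 := fun i hi => hr0 (by rw [← ha, prod_eq_zero (mem_univ i) hi])
  have hb0 : ∀ i, b i ≠ 0 := fun i hi => hr0 (by rw [← hb, prod_eq_zero (mem_univ i) hi])
  have hc : ContinuousAt (integrandRatio q r a b M N m) 0 := by
    unfold integrandRatio
    refine ContinuousAt.mul (tendsto_finsetProd _ fun i _ => ContinuousAt.div (by fun_prop)
      (by fun_prop) ?_) continuousAt_const
    have := hb0 i
    simp [hq0, hr0, hb0 i, zpow_ne_zero]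
  have h0 : integrandRatio q r a b M N m 0 = q ^ 2 := by
    have hN' : ∏ i, q ^ N i = 1 := by
      rw [Fin.sum_univ_three] at hN
      rw [Fin.prod_univ_three, ← zpow_add₀ hq0, ← zpow_add₀ hq0, hN, zpow_zero]
    have e : ∀ i, (q * 0 - q * r ^ m / a i) * (1 - q ^ M i * r ^ m * a i * 0) /
        ((q * 0 - q ^ N i * r ^ (-m) * b i) * (1 - q * r ^ (-m) / b i * 0)) =
        q * q ^ m * ((a i)⁻¹ * (b i)⁻¹ * (q ^ N i)⁻¹) := fun i => by
      have hrm2 : q ^ m = r ^ m * r ^ m := by rw [← hr, pow_two, mul_zpow]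
      rw [hrm2, zpow_neg]
      have := ha0 i
      have := hb0 i
      have := zpow_ne_zero m hr0
      have := zpow_ne_zero (N i) hq0
      simp only [mul_zero, zero_sub, sub_zero, mul_one]
      field_simp
    rw [integrandRatio]
    simp only [e, prod_mul_distrib, prod_inv_distrib, ha, hb, hN', prod_const, card_univ,
      Fintype.card_fin]
    rw [show (-3 * m) = -(m * (3 : ℕ)) by push_cast; ring, zpow_neg, zpow_mul, zpow_natCast]
    have := zpow_ne_zero m hq0
    have hq' : (r * r)⁻¹ = q⁻¹ := by rw [← hr, pow_two]
    rw [← mul_inv, hq']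
    field_simp
  rw [← h0]
  exact hc.tendsto

theorem exists_norm_integrand_mul_left_le (hq : ‖q‖ < 1) (hr0 : r ≠ 0) (hr : r ^ 2 = q)
    (ha : ∏ i, a i = r) (hb : ∏ i, b i = r) (hN : ∑ i, N i = 0) :
    ∃ δ > 0, ∀ z : ℂ, z ≠ 0 → ‖z‖ < δ →
      ‖integrand q r a b M N m (q * z)‖ ≤ ‖q‖ * ‖integrand q r a b M N m z‖ := by
  have hq0 : q ≠ 0 := by rw [← hr]; positivity
  -- The limit q² has norm strictly below ‖q‖, which leaves room for a contraction by ‖q‖ near the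
  -- origin.
  have h1 : ∀ᶠ z in 𝓝 (0 : ℂ), ‖integrandRatio q r a b M N m z‖ < ‖q‖ :=
    (tendsto_integrandRatio hq0 hr0 hr ha hb hN).norm.eventually_lt_const (by
      rw [norm_pow]
      nlinarith [norm_pos_iff.2 hq0])
  have h2 : ∀ c : Fin 3 → ℂ, ∀ᶠ z in 𝓝 (0 : ℂ), ∀ i, 1 - c i * z ≠ 0 := fun c =>
    eventually_all.2 fun i => ContinuousAt.eventually_ne (by fun_prop) (by simp)
  obtain ⟨δ, hδ, h⟩ := Metric.eventually_nhds_iff.1 (h1.and ((h2 _).and (h2 _)))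
  refine ⟨δ, hδ, fun z hz hzδ => ?_⟩
  obtain ⟨h1, h2, h3⟩ := h (by simpa using hzδ)
  rw [integrand_mul_left hq hq0 hz h2 h3, norm_mul]
  gcongr

theorem norm_integrand_pow_mul_le (hq : ‖q‖ < 1) (hq0 : q ≠ 0) {δ : ℝ}
    (h : ∀ z : ℂ, z ≠ 0 → ‖z‖ < δ →
      ‖integrand q r a b M N m (q * z)‖ ≤ ‖q‖ * ‖integrand q r a b M N m z‖)
    {z : ℂ} (hz : z ≠ 0) (hzδ : ‖z‖ < δ) (n : ℕ) :
    ‖integrand q r a b M N m (q ^ n * z)‖ ≤ ‖q‖ ^ n * ‖integrand q r a b M N m z‖ := by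
  induction n with
  | zero => simp
  | succ n ih =>
    rw [pow_succ', mul_assoc, pow_succ', mul_assoc]
    refine (h _ (mul_ne_zero (pow_ne_zero _ hq0) hz) ?_).trans (by gcongr)
    rw [norm_mul, norm_pow]
    exact (mul_le_of_le_one_left (norm_nonneg _) (pow_le_one₀ (norm_nonneg _) hq.le)).trans_lt hzδ

/-- Scaling by q^n maps the first circle to the n-th one and shrinks the integrand by ‖q‖^n, while
dz/z is scale invariant. -/
theorem tendsto_circleIntegral_integrand (hq : ‖q‖ < 1) (hq0 : q ≠ 0) {δ ρ : ℝ} (hρ : 0 < ρ)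
    (hρδ : ρ < δ)
    (h : ∀ z : ℂ, z ≠ 0 → ‖z‖ < δ →
      ‖integrand q r a b M N m (q * z)‖ ≤ ‖q‖ * ‖integrand q r a b M N m z‖)
    (h1 : ∀ x, ‖poleZero q r b N m x‖ ≠ ρ) (h2 : ∀ x, ‖poleInfinity q r a M m x‖ ≠ ρ) :
    Tendsto (fun n : ℕ => ∮ z in C(0, ρ * ‖q‖ ^ n),
      integrand q r a b M N m z / (2 * Real.pi * Complex.I * z)) atTop (𝓝 0) := by
  have hcont : ContinuousOn (integrand q r a b M N m) (Metric.sphere 0 ρ) := fun z hz => by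
    have hz' : ‖z‖ = ρ := by simpa using hz
    refine (differentiableAt_integrand hq hq0 (norm_pos_iff.1 (hz' ▸ hρ)) ?_
      ?_).continuousAt.continuousWithinAt
    · exact fun x hx => h1 x (by rw [← hx, hz'])
    · exact fun x hx => h2 x (by rw [← hx, hz'])
  obtain ⟨C, hC⟩ := (isCompact_sphere (0 : ℂ) ρ).exists_bound_of_continuousOn hcont
  have hqn : ∀ n : ℕ, 0 < ‖q‖ ^ n := fun n => pow_pos (norm_pos_iff.2 hq0) n
  have hbound : ∀ n : ℕ, ‖∮ z in C(0, ρ * ‖q‖ ^ n),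
      integrand q r a b M N m z / (2 * Real.pi * Complex.I * z)‖ ≤ C * ‖q‖ ^ n := fun n => by
    have hρn : 0 < ρ * ‖q‖ ^ n := mul_pos hρ (hqn n)
    refine (circleIntegral.norm_integral_le_of_norm_le_const hρn.le
      (C := ‖q‖ ^ n * C / (2 * Real.pi * (ρ * ‖q‖ ^ n))) fun z hz => ?_).trans_eq ?_
    · have hz' : ‖z‖ = ρ * ‖q‖ ^ n := by simpa using hz
      have hw : z = q ^ n * (z / q ^ n) := by field_simp
      have hwn : ‖z / q ^ n‖ = ρ := by
        rw [norm_div, norm_pow, hz', mul_div_cancel_right₀ _ (hqn n).ne']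
      have hle : ‖integrand q r a b M N m z‖ ≤ ‖q‖ ^ n * C := by
        rw [hw]
        refine (norm_integrand_pow_mul_le hq hq0 h (norm_pos_iff.1 (hwn ▸ hρ))
          (hwn ▸ hρδ) n).trans ?_
        gcongr
        exact hC _ (by simpa using hwn)
      have hn : ‖2 * Real.pi * Complex.I * z‖ = 2 * Real.pi * (ρ * ‖q‖ ^ n) := by
        rw [norm_mul, hz']
        simp [Real.pi_pos.le]
      rw [norm_div, hn]
      gcongr
    · have := Real.pi_pos.ne'
      have := hρ.ne'
      have := (hqn n).ne'
      field_simp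
  refine squeeze_zero_norm hbound ?_
  simpa using (tendsto_pow_atTop_nhds_zero_of_lt_one (norm_nonneg q) hq).const_mul C

theorem exists_norm_poleZero_lt (hq : ‖q‖ < 1) (hq0 : q ≠ 0) :
    ∃ C > 0, ∀ x, ‖poleZero q r b N m x‖ < C := by
  refine ⟨∑ j, ‖q ^ N j * r ^ (-m) * b j‖ + 1, by positivity, fun ⟨j, s⟩ => ?_⟩
  rw [poleZero_eq_mul_pow hq0, norm_mul, norm_pow]
  have h1 := mul_le_of_le_one_right (norm_nonneg (q ^ N j * r ^ (-m) * b j))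
    (pow_le_one₀ (n := s) (norm_nonneg _) hq.le)
  have h2 := single_le_sum (f := fun j => ‖q ^ N j * r ^ (-m) * b j‖)
    (fun _ _ => norm_nonneg _) (mem_univ j)
  linarith

theorem finite_lt_norm_poleZero (hq : ‖q‖ < 1) (hq0 : q ≠ 0) {ε : ℝ} (hε : 0 < ε) :
    {x | ε < ‖poleZero q r b N m x‖}.Finite := by
  have h : ∀ j, {s : ℕ | ε < ‖poleZero q r b N m (j, s)‖}.Finite := fun j => by
    have ht : Tendsto (fun s : ℕ => ‖poleZero q r b N m (j, s)‖) atTop (𝓝 0) := by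
      simp only [poleZero_eq_mul_pow hq0]
      simpa using (tendsto_mul_pow hq (q ^ N j * r ^ (-m) * b j)).norm
    rw [← Nat.cofinite_eq_atTop] at ht
    have := ht.eventually_lt_const hε
    exact (eventually_cofinite.1 this).subset fun s hs => not_lt.2 (le_of_lt hs)
  refine (Set.finite_iUnion fun j => (h j).image (Prod.mk j)).subset fun x hx => ?_
  exact Set.mem_iUnion.2 ⟨x.1, x.2, hx, rfl⟩

theorem poleInfinity_eq_inv_poleZero (x : Fin 3 × ℕ) :
    poleInfinity q r a M m x = (poleZero q r a M (-m) x)⁻¹ := by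
  rw [poleInfinity, poleZero, neg_neg]

theorem exists_lt_norm_poleInfinity (hq : ‖q‖ < 1) (hq0 : q ≠ 0) (hr0 : r ≠ 0)
    (ha0 : ∀ i, a i ≠ 0) : ∃ δ > 0, ∀ x, δ < ‖poleInfinity q r a M m x‖ := by
  obtain ⟨C, hC, h⟩ := exists_norm_poleZero_lt (r := r) (b := a) (N := M) (m := -m) hq hq0
  refine ⟨C⁻¹, inv_pos.2 hC, fun x => ?_⟩
  rw [poleInfinity_eq_inv_poleZero, norm_inv]
  exact inv_strictAnti₀ (norm_pos_iff.2 (poleZero_ne_zero hq0 hr0 ha0 x)) (h x)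

theorem finite_norm_poleInfinity_lt (hq : ‖q‖ < 1) (hq0 : q ≠ 0) (hr0 : r ≠ 0)
    (ha0 : ∀ i, a i ≠ 0) {R : ℝ} (hR : 0 < R) :
    {x | ‖poleInfinity q r a M m x‖ < R}.Finite := by
  refine (finite_lt_norm_poleZero (r := r) (b := a) (N := M) (m := -m) hq hq0
    (inv_pos.2 hR)).subset fun x hx => ?_
  rw [Set.mem_ofPred_eq, poleInfinity_eq_inv_poleZero, norm_inv] at hx
  exact inv_lt_of_inv_lt₀ (norm_pos_iff.2 (poleZero_ne_zero hq0 hr0 ha0 x)) hx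

/-- The value of a contour integral as an integral over a small circle and a finite sum of
residues. -/
theorem contourIntegral_integrand_eq_add (hq : ‖q‖ < 1) (hr0 : r ≠ 0) (hr : r ^ 2 = q)
    (ha : ∏ i, a i = r) (hb : ∏ i, b i = r) (hN : ∑ i, N i = 0) (hgen : IsGeneric q a b)
    {w : ℂ} {γ : Path w w} (hγ : IsSeparatingContour γ (polesToZero q r b N m)
      (polesToInfinity q r a M m)) {ρ : ℝ} (hρ : 0 < ρ) (hργ : ∀ t, ρ < ‖γ t‖)
    (h1 : ∀ x, ‖poleZero q r b N m x‖ ≠ ρ) (h2 : ∀ x, ρ < ‖poleInfinity q r a M m x‖)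
    {T : Finset (Fin 3 × ℕ)} (hT : ∀ x, x ∈ T ↔ ρ < ‖poleZero q r b N m x‖) :
    contourIntegral (fun z => integrand q r a b M N m z / (2 * Real.pi * Complex.I * z)) γ =
      (∮ z in C(0, ρ), integrand q r a b M N m z / (2 * Real.pi * Complex.I * z)) +
        ∑ x ∈ T, residueAt q r a b M N m x.1 x.2 (poleZero q r b N m x) := by
  have hq0 : q ≠ 0 := by rw [← hr]; positivity
  have ha0 : ∀ i, a i ≠ 0 := fun i hi => hr0 (by rw [← ha, prod_eq_zero (mem_univ i) hi])
  have hb0 : ∀ i, b i ≠ 0 := fun i hi => hr0 (by rw [← hb, prod_eq_zero (mem_univ i) hi])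
  have hπ : (2 * Real.pi * Complex.I : ℂ) ≠ 0 := Complex.two_pi_I_ne_zero
  set F : ℂ → ℂ := fun z => integrand q r a b M N m z / (2 * Real.pi * Complex.I * z) with hFdef
  have hF : ∀ p z : ℂ, (z - p) * F z =
      (z - p) * (integrand q r a b M N m z / z) / (2 * Real.pi * Complex.I) := fun p z => by
    simp only [hFdef]
    rw [mul_comm _ z, ← div_div, mul_div_assoc]
  obtain ⟨R₁, hR₁⟩ : ∃ R, ∀ t, ‖γ t‖ ≤ R := by
    obtain ⟨R, hR⟩ := isCompact_univ.exists_bound_of_continuousOn (f := γ) (by fun_prop)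
    exact ⟨R, fun t => hR t (Set.mem_univ t)⟩
  obtain ⟨R₂, hR₂, hzero⟩ := exists_norm_poleZero_lt (r := r) (b := b) (N := N) (m := m) hq hq0
  set R := max (R₁ + 1) (max R₂ (ρ + 1)) with hRdef
  have hR1 : R₁ < R := (lt_add_one _).trans_le (le_max_left _ _)
  have hR2 : R₂ ≤ R := (le_max_left _ _).trans (le_max_right _ _)
  have hρR : ρ < R := (lt_add_one _).trans_le ((le_max_right _ _).trans (le_max_right _ _))
  have hε : 0 < ρ / 2 := half_pos hρ
  have hερ : ρ / 2 < ρ := half_lt_self hρ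
  let X := (finite_lt_norm_poleZero (r := r) (b := b) (N := N) (m := m) hq hq0 hε).toFinset
  let Y := (finite_norm_poleInfinity_lt (r := r) (a := a) (M := M) (m := m) hq hq0 hr0 ha0
    (hρ.trans hρR)).toFinset
  have hX : ∀ x, x ∈ X ↔ ρ / 2 < ‖poleZero q r b N m x‖ := fun x => by simp [X]
  have hY : ∀ x, x ∈ Y ↔ ‖poleInfinity q r a M m x‖ < R := fun x => by simp [Y]
  -- All denominator zeros in the annulus are included, also those cancelled by the numerator. The
  -- latter have c p = 0, so it does not matter whether the contour meets them or how it winds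
  -- around them.
  let P := X.image (poleZero q r b N m) ∪ Y.image (poleInfinity q r a M m)
  let c : ℂ → ℂ := fun p => limUnder (𝓝[≠] p) fun z => (z - p) * F z
  have hlimX : ∀ x, Tendsto (fun z => (z - poleZero q r b N m x) * F z)
      (𝓝[≠] poleZero q r b N m x)
      (𝓝 (residueAt q r a b M N m x.1 x.2 (poleZero q r b N m x) / (2 * Real.pi * Complex.I))) :=
    fun ⟨j, s⟩ => by
      simp only [hF]
      exact (tendsto_integrand_poleZero hq hq0 hr0 ha0 hb0 hgen j s).div_const _
  have hcX : ∀ x, c (poleZero q r b N m x) =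
      residueAt q r a b M N m x.1 x.2 (poleZero q r b N m x) / (2 * Real.pi * Complex.I) :=
    fun x => (hlimX x).limUnder_eq
  have hlimY : ∀ x, ∃ d, Tendsto (fun z => (z - poleInfinity q r a M m x) * F z)
      (𝓝[≠] poleInfinity q r a M m x) (𝓝 d) ∧ (x.2 < -m - M x.1 → d = 0) := fun ⟨j, s⟩ => by
    simp only [hF]
    obtain ⟨d, hd, hd0⟩ := tendsto_integrand_poleInfinity (M := M) (N := N) (m := m) (b := b)
      hq hq0 hr0 hr ha0 hgen j s
    exact ⟨_, hd.div_const _, fun h => by rw [hd0 h, zero_div]⟩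
  have hcY : ∀ x, x.2 < -m - M x.1 → c (poleInfinity q r a M m x) = 0 := fun x hx => by
    obtain ⟨d, hd, hd0⟩ := hlimY x
    rw [← hd0 hx]
    exact hd.limUnder_eq
  have hXsep : ∀ x, m - N x.1 ≤ x.2 → poleZero q r b N m x ∉ Set.range γ ∧
      windingNumber γ (poleZero q r b N m x) = 1 := fun x hx =>
    hγ.inside _ (Set.mem_insert_of_mem _ ⟨x.1, x.2, Int.natCast_nonneg _, hx, rfl⟩)
  have hYsep : ∀ x, -m - M x.1 ≤ x.2 → poleInfinity q r a M m x ∉ Set.range γ ∧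
      windingNumber γ (poleInfinity q r a M m x) = 0 := fun x hx =>
    hγ.outside _ ⟨x.1, x.2, Int.natCast_nonneg _, hx, rfl⟩
  have hcX0 : ∀ x : Fin 3 × ℕ, x.2 < m - N x.1 →
      residueAt q r a b M N m x.1 x.2 (poleZero q r b N m x) = 0 := fun ⟨j, s⟩ hx =>
    residueAt_eq_zero hq hr0 hr ha hb hN hgen hx
  have hPcases : ∀ p ∈ P, (∃ x, ρ / 2 < ‖poleZero q r b N m x‖ ∧ poleZero q r b N m x = p) ∨
      ∃ x, ‖poleInfinity q r a M m x‖ < R ∧ poleInfinity q r a M m x = p := fun p hp => by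
    simpa only [P, mem_union, mem_image, hX, hY] using hp
  have hmain := contourIntegral_eq_circleIntegral_add (ε := ρ / 2) (R := R) (ρ := ρ) (P := P)
    (F := F) (c := c) hε hερ hρR ?_ ?_ ?_ ?_ hγ.piecewiseC1 ?_
    (hγ.inside 0 (Set.mem_insert _ _)).2 ?_
  · rw [hmain, sum_union, sum_image, sum_image]
    · congr 1
      have hYsum : ∑ x ∈ Y, c (poleInfinity q r a M m x) *
          (windingNumber γ (poleInfinity q r a M m x) -
            if ‖poleInfinity q r a M m x‖ < ρ then 1 else 0) = 0 := by
        refine sum_eq_zero fun x _ => ?_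
        rw [if_neg (h2 x).not_gt, sub_zero]
        rcases lt_or_ge (x.2 : ℤ) (-m - M x.1) with h | h
        · rw [hcY x h, zero_mul]
        · rw [(hYsep x h).2, mul_zero]
      have hTX : T = X.filter fun x => ρ < ‖poleZero q r b N m x‖ := by
        ext x
        rw [mem_filter, hT, hX]
        exact ⟨fun h => ⟨hερ.trans h, h⟩, fun h => h.2⟩
      rw [hYsum, add_zero, hTX, sum_filter, mul_sum]
      refine sum_congr rfl fun x _ => ?_
      rw [hcX]
      rcases lt_or_ge (x.2 : ℤ) (m - N x.1) with h | h
      · simp [hcX0 x h]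
      · rw [(hXsep x h).2]
        rcases lt_or_gt_of_ne (h1 x) with h' | h'
        · simp [h', h'.not_gt]
        · simp only [h', h'.not_gt, if_true, if_false, sub_zero, mul_one]
          exact mul_div_cancel₀ _ hπ
    · exact (poleInfinity_injective hq hq0 hr0 ha0 hgen).injOn
    · exact (poleZero_injective hq hq0 hr0 hb0 hgen).injOn
    · rw [disjoint_left]
      intro p hp hp'
      obtain ⟨x, -, rfl⟩ := mem_image.1 hp
      obtain ⟨y, -, hy⟩ := mem_image.1 hp'
      exact poleZero_ne_poleInfinity hq0 hr0 ha0 hgen x y hy.symm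
  · intro p hp
    rcases hPcases p hp with ⟨x, hx, rfl⟩ | ⟨x, hx, rfl⟩
    · exact ⟨hx, (hzero x).trans_le hR2⟩
    · exact ⟨hερ.trans (h2 x), hx⟩
  · rintro z ⟨⟨hz1, hz2⟩, hzP⟩
    have hz0 : z ≠ 0 := norm_pos_iff.1 (hε.trans hz1)
    have hd := differentiableAt_integrand (a := a) (b := b) (r := r) (M := M) (N := N) (m := m)
      hq hq0 hz0
      (fun x hx => hzP (mem_union_left _ (mem_image.2 ⟨x, (hX x).2 (hx ▸ hz1), hx.symm⟩)))
      (fun x hx => hzP (mem_union_right _ (mem_image.2 ⟨x, (hY x).2 (hx ▸ hz2), hx.symm⟩)))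
    exact (hd.div (differentiableAt_id.const_mul _)
      (mul_ne_zero hπ hz0)).differentiableWithinAt
  · intro p hp
    refine tendsto_nhds_limUnder ?_
    rcases hPcases p hp with ⟨x, -, rfl⟩ | ⟨x, -, rfl⟩
    · exact ⟨_, hlimX x⟩
    · obtain ⟨d, hd, -⟩ := hlimY x
      exact ⟨d, hd⟩
  · intro p hp
    rcases hPcases p hp with ⟨x, -, rfl⟩ | ⟨x, -, rfl⟩
    · exact h1 x
    · exact (h2 x).ne'
  · intro t ht
    rw [γ.extend_apply ht]
    exact ⟨hερ.trans (hργ _), (hR₁ _).trans_lt hR1⟩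
  · intro p hp hcp
    rcases hPcases p hp with ⟨x, -, rfl⟩ | ⟨x, -, rfl⟩
    · refine (hXsep x (le_of_not_gt fun h => hcp ?_)).1
      rw [hcX, hcX0 x h, zero_div]
    · exact (hYsep x (le_of_not_gt fun h => hcp (hcY x h))).1

/-- Let the comparison circle shrink through the radii ρ‖q‖^n: its integral tends to 0, and the
finite sets of poles outside it exhaust all poles tending to 0. -/
theorem contourIntegral_integrand_eq_tsum (hq : ‖q‖ < 1) (hr0 : r ≠ 0) (hr : r ^ 2 = q)
    (ha : ∏ i, a i = r) (hb : ∏ i, b i = r) (hN : ∑ i, N i = 0) (hgen : IsGeneric q a b)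
    {w : ℂ} {γ : Path w w} (hγ : IsSeparatingContour γ (polesToZero q r b N m)
      (polesToInfinity q r a M m)) {S : ℂ}
    (hS : HasSum (fun x : Fin 3 × ℕ =>
      residueAt q r a b M N m x.1 x.2 (poleZero q r b N m x)) S) :
    contourIntegral (fun z => integrand q r a b M N m z / (2 * Real.pi * Complex.I * z)) γ = S := by
  have hq0 : q ≠ 0 := by rw [← hr]; positivity
  have ha0 : ∀ i, a i ≠ 0 := fun i hi => hr0 (by rw [← ha, prod_eq_zero (mem_univ i) hi])
  have hqp : 0 < ‖q‖ := norm_pos_iff.2 hq0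
  obtain ⟨δ₁, hδ₁, hint⟩ := exists_norm_integrand_mul_left_le (m := m) (M := M) hq hr0 hr ha hb hN
  obtain ⟨δ₂, hδ₂, hinf⟩ := exists_lt_norm_poleInfinity (r := r) (m := m) (M := M) hq hq0 hr0 ha0
  obtain ⟨δ₃, hδ₃, hγn⟩ : ∃ δ > 0, ∀ t, δ ≤ ‖γ t‖ := by
    obtain ⟨t, -, ht⟩ := isCompact_univ.exists_isMinOn (f := fun t => ‖γ t‖) Set.univ_nonempty
      (by fun_prop)
    refine ⟨‖γ t‖, norm_pos_iff.2 fun h0 => ?_, fun s => ht (Set.mem_univ s)⟩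
    exact (hγ.inside 0 (Set.mem_insert _ _)).1 ⟨t, h0⟩
  -- The radius lies in the contraction region, below all poles tending to infinity and below the
  -- contour. Avoiding a countable set keeps every circle of radius ρ‖q‖^n free of poles.
  obtain ⟨ρ, ⟨hρ, hρδ⟩, hρp⟩ : ∃ ρ ∈ Set.Ioo 0 (min δ₁ (min δ₂ δ₃)),
      ρ ∉ Set.range fun y : (Fin 3 × ℕ) × ℕ => ‖poleZero q r b N m y.1‖ / ‖q‖ ^ y.2 := by
    have := ((Set.countable_range fun y : (Fin 3 × ℕ) × ℕ =>
      ‖poleZero q r b N m y.1‖ / ‖q‖ ^ y.2).dense_compl ℝ).exists_mem_open isOpen_Ioo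
        (Set.nonempty_Ioo.2 (lt_min hδ₁ (lt_min hδ₂ hδ₃)))
    obtain ⟨ρ, h1, h2⟩ := this
    exact ⟨ρ, h2, h1⟩
  obtain ⟨hρ1, hρ23⟩ := lt_min_iff.1 hρδ
  obtain ⟨hρ2, hρ3⟩ := lt_min_iff.1 hρ23
  have hρn : ∀ n : ℕ, 0 < ρ * ‖q‖ ^ n := fun n => by positivity
  have hle : ∀ n : ℕ, ρ * ‖q‖ ^ n ≤ ρ := fun n =>
    mul_le_of_le_one_right hρ.le (pow_le_one₀ hqp.le hq.le)
  have hne : ∀ x (n : ℕ), ‖poleZero q r b N m x‖ ≠ ρ * ‖q‖ ^ n := fun x n h =>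
    hρp ⟨(x, n), by simp only [h]; field_simp⟩
  let T : ℕ → Finset (Fin 3 × ℕ) := fun n =>
    (finite_lt_norm_poleZero (r := r) (b := b) (N := N) (m := m) hq hq0 (hρn n)).toFinset
  have hT : ∀ n x, x ∈ T n ↔ ρ * ‖q‖ ^ n < ‖poleZero q r b N m x‖ := fun n x => by
    simp [T]
  have hlim : Tendsto (fun n : ℕ => ρ * ‖q‖ ^ n) atTop (𝓝 0) := by
    simpa using (tendsto_pow_atTop_nhds_zero_of_lt_one hqp.le hq).const_mul ρ
  have hTtop : Tendsto T atTop atTop := by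
    refine tendsto_atTop_finset_of_monotone (fun i j hij x hx => ?_) fun x => ?_
    · rw [hT] at hx ⊢
      refine lt_of_le_of_lt ?_ hx
      exact mul_le_mul_of_nonneg_left (pow_le_pow_of_le_one hqp.le hq.le hij) hρ.le
    · simp only [hT]
      have hb0 : ∀ i, b i ≠ 0 := fun i hi => hr0 (by rw [← hb, prod_eq_zero (mem_univ i) hi])
      exact (hlim.eventually_lt_const (norm_pos_iff.2 (poleZero_ne_zero hq0 hr0 hb0 x))).exists
  have hcirc := tendsto_circleIntegral_integrand hq hq0 hρ hρ1 hint
    (fun x => by simpa using hne x 0) (fun x => (hρ2.trans (hinf x)).ne')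
  have := hcirc.add (hS.comp hTtop)
  rw [zero_add] at this
  refine tendsto_nhds_unique (tendsto_const_nhds.congr fun n => ?_) this
  exact contourIntegral_integrand_eq_add hq hr0 hr ha hb hN hgen hγ (hρn n)
    (fun t => ((hle n).trans_lt hρ3).trans_le (hγn t)) (fun x => hne x n)
    (fun x => ((hle n).trans_lt hρ2).trans (hinf x)) (hT n)

end SQED

end

/-! ### Summation over m -/

noncomputable section

namespace SQED

open Filter Topology MeasureTheory Finset

variable {q r : ℂ} {a b : Fin 3 → ℂ} {M N : Fin 3 → ℤ}

theorem hasSum_saalFun_int (hq : ‖q‖ < 1) (hq0 : q ≠ 0) (hab : (∏ i, a i) * ∏ i, b i = q)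
    (hgen : IsGeneric q a b) (j : Fin 3) :
    HasSum (fun n : ℤ => saalFun q a b (b j * q ^ n)) (saalSeries q a b j) := by
  have hb0 : ∀ i, b i ≠ 0 := fun i hi =>
    hq0 (by rw [← hab, prod_eq_zero (mem_univ i) hi, mul_zero])
  have h := (summable_saalFun hq hab hb0 j
    (qPoch_ne_zero_of_ne_zpow hq hq0 (hgen.mul_ne 0 j))).hasSum
  refine (Function.Injective.hasSum_iff Nat.cast_injective (fun n hn => ?_)).1
    (by simpa [Function.comp_def, saalSeries] using h)
  refine saalFun_mul_zpow_eq_zero hq hq0 hb0 j (lt_of_not_ge fun h0 => hn ⟨n.toNat, ?_⟩)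
  exact Int.toNat_of_nonneg h0

/-- The index change `(m, s) ↦ (s - m + N, s)`. -/
def shearEquiv (N : ℤ) : ℤ × ℕ ≃ ℤ × ℕ where
  toFun x := (x.2 - x.1 + N, x.2)
  invFun x := (x.2 - x.1 + N, x.2)
  left_inv x := Prod.ext (by ring) rfl
  right_inv x := Prod.ext (by ring) rfl

/-- The shear decouples the two indices, turning the double series into a product of two absolutely
convergent ones. -/
theorem hasSum_mul_shear {f : ℤ → ℂ} {g : ℕ → ℂ} {A B : ℂ} (hf : HasSum f A) (hg : HasSum g B)
    (N : ℤ) : HasSum (fun x : ℤ × ℕ => f (x.2 - x.1 + N) * g x.2) (A * B) :=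
  (shearEquiv N).hasSum_iff.2
    (hf.mul hg (summable_mul_of_summable_norm hf.summable.norm hg.summable.norm))

theorem prod_zpow_mul (hq0 : q ≠ 0) (hM : ∑ i, M i = 0) : ∏ i, q ^ M i * a i = ∏ i, a i := by
  have h1 : ∏ i, q ^ M i = 1 := by
    rw [Fin.sum_univ_three] at hM
    rw [Fin.prod_univ_three, ← zpow_add₀ hq0, ← zpow_add₀ hq0, hM, zpow_zero]
  rw [prod_mul_distrib, h1, one_mul]

theorem hasSum_fintype_prod {f : Fin 3 × ℕ → ℂ} {g : Fin 3 → ℂ}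
    (h : ∀ j, HasSum (fun s => f (j, s)) (g j)) : HasSum f (∑ j, g j) := by
  have hs : Summable f := Summable.of_norm ((summable_prod_of_nonneg fun _ => norm_nonneg _).2
    ⟨fun j => (h j).summable.norm, Summable.of_finite⟩)
  have := (hs.hasSum.prod_fiberwise h).unique (hasSum_fintype g)
  exact this ▸ hs.hasSum

/-- For fixed j, all residues over all m form one absolutely convergent double series by the
factorization in `residueAt_eq`. -/
theorem hasSum_residueAt (hq : ‖q‖ < 1) (hr0 : r ≠ 0) (hr : r ^ 2 = q)
    (ha : ∏ i, a i = r) (hb : ∏ i, b i = r)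
    (hM : ∑ i, M i = 0) (hN : ∑ i, N i = 0) (hgen : IsGeneric q a b) (j : Fin 3) :
    HasSum (fun x : ℤ × ℕ => residueAt q r a b M N x.1 j x.2 (poleZero q r b N x.1 (j, x.2)))
      (residueCoeff q r a b N j * saalSeries q a b j *
        saalSeries q (fun i => q ^ M i * a i) (fun i => q ^ N i * b i) j) := by
  have hq0 : q ≠ 0 := by rw [← hr]; positivity
  have hb0 : ∀ i, b i ≠ 0 := fun i hi => hr0 (by rw [← hb, prod_eq_zero (mem_univ i) hi])
  have hab : (∏ i, a i) * ∏ i, b i = q := by rw [ha, hb, ← pow_two, hr]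
  have h1 := hasSum_saalFun_int hq hq0 hab hgen j
  have h2 : HasSum (fun s : ℕ => saalFun q (fun i => q ^ M i * a i) (fun i => q ^ N i * b i)
      (q ^ N j * b j * q ^ s))
      (saalSeries q (fun i => q ^ M i * a i) (fun i => q ^ N i * b i) j) :=
    (summable_saalFun hq (by rw [prod_zpow_mul hq0 hM, prod_zpow_mul hq0 hN, hab])
      (fun i => mul_ne_zero (zpow_ne_zero _ hq0) (hb0 i)) j
      (qPoch_ne_zero_of_ne_zpow hq hq0 ((hgen.shift hq0 M N).mul_ne 0 j))).hasSum
  rw [mul_assoc]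
  have h3 := (hasSum_mul_shear h1 h2 (N j)).mul_left (residueCoeff q r a b N j)
  have e : ∀ x : ℤ × ℕ, residueAt q r a b M N x.1 j x.2 (poleZero q r b N x.1 (j, x.2)) =
      residueCoeff q r a b N j * (saalFun q a b (b j * q ^ (x.2 - x.1 + N j)) *
        saalFun q (fun i => q ^ M i * a i) (fun i => q ^ N i * b i) (q ^ N j * b j * q ^ x.2)) :=
    fun x => by
      rw [poleZero, residueAt_eq hq hr0 hr ha hb hN hgen, mul_assoc]
  simpa only [e] using h3

end SQED

end

theorem theorem3 (q r : ℂ) (hq0 : q ≠ 0) (hq1 : ‖q‖ < 1) (hr : r ^ 2 = q)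
    (a b : Fin 3 → ℂ) (M N : Fin 3 → ℤ)
    (ha : ∏ j, a j = r) (hb : ∏ j, b j = r)
    (hM : ∑ j, M j = 0) (hN : ∑ j, N j = 0)
    (hgen : SQED.IsGeneric q a b)
    (x : ℤ → ℂ) (γ : ∀ m : ℤ, Path (x m) (x m))
    (hγ : ∀ m : ℤ, SQED.IsSeparatingContour (γ m)
      (SQED.polesToZero q r b N m) (SQED.polesToInfinity q r a M m)) :
    HasSum
      (fun m : ℤ => SQED.contourIntegral
        (fun z => SQED.integrand q r a b M N m z / (2 * Real.pi * Complex.I * z)) (γ m))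
      ((∏ j, q ^ (Ring.choose (M j) 2 + Ring.choose (N j) 2) * a j ^ M j * b j ^ N j)⁻¹ *
        ∏ j, ∏ k, SQED.qPoch (q / (a j * b k)) q /
          SQED.qPoch (a j * b k * q ^ (M j + N k)) q) := by
  have hr0 : r ≠ 0 := fun h => hq0 (by rw [← hr, h]; simp)
  have h := fun j => SQED.hasSum_residueAt hq1 hr0 hr ha hb hM hN hgen j
  rw [← SQED.sum_residueCoeff_mul hq1 hr0 hr ha hb hM hN hgen]
  have hfib : ∀ m j, Summable fun s : ℕ =>
      SQED.residueAt q r a b M N m j s (SQED.poleZero q r b N m (j, s)) := fun m j =>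
    (h j).summable.prod_factor m
  -- Summability over pairs (m, s) permits summing over s first. Together with the sum over j, the
  -- inner sum for each m is the residue sum that equals the contour integral.
  convert hasSum_sum fun j _ => (h j).prod_fiberwise fun m => (hfib m j).hasSum using 2 with m
  exact SQED.contourIntegral_integrand_eq_tsum hq1 hr0 hr ha hb hN hgen (hγ m)
    (SQED.hasSum_fintype_prod fun j => (hfib m j).hasSum)
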